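/- A **web diagram** on $n$ pegs is a finite set $D$ of edges $(x,y,a,b)$ with $1\le x<y\le n$ and $a,b$ positive integers (the edge joins height $a$ on peg $x$ to height $b$ on peg $y$) such that, for each peg $i$, the set of heights of edge ends on peg $i$ is $\{1,\dots,p_i(D)\}$, where $p_i(D)$ is the number of edges of $D$ incident with peg $i$. Its **web world** $W(D)$ is the set of all diagrams obtained from $D$ by permuting the heights on each peg arbitrarily. The **web graph** $G(W)$ has as vertices the pegs that occur; two pegs are adjacent if some edge of $D$ joins them, and this edge of $G(W)$ is labelled by the number of edges of $D$ joining them. The sum $D\oplus E$ places $E$ on top of $D$: $D\oplus E=D\cup\{(x,y,a+p_x(D),b+p_y(D)):(x,y,a,b)\in E\}$. For $X\subseteq D$, $\mathrm{rel}(X)$ is obtained by relabelling the heights of $X$ on each peg by $1,2,\dots$ in an order-preserving way. An **$\ell$-colouring** of $D$ ($1\le \ell\le |D|$) is a surjection $c$ from the edges of $D$ onto $\{1,\dots,\ell\}$; its **reconstruction** is $\mathrm{rel}(c^{-1}(1))\oplus\cdots\oplus\mathrm{rel}(c^{-1}(\ell))$. Let $f(D_1,D_2,\ell)$ be the number of $\ell$-colourings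 of $D_1$ whose reconstruction is $D_2$. For a web world $W$ define the matrices, indexed by $W$, $$M(x)_{D_1,D_2}=\sum_{\ell\ge1}x^{\ell}f(D_1,D_2,\ell)\in\mathbb{Q}[x],\qquad R_{D_1,D_2}=\sum_{\ell\ge1}\frac{(-1)^{\ell-1}}{\ell}f(D_1,D_2,\ell)\in\mathbb{Q}.$$ A non-empty web diagram is **indecomposable** if it is not a sum of two non-empty web diagrams. If $D=E_1\oplus\cdots\oplus E_k$ with all $E_i$ indecomposable, the **decomposition poset** $P(D)$ is $\{E_1,\dots,E_k\}$ (one element for each index) with the reflexive-transitive closure of the relation: $i<j$ and, in $D$, an endpoint of an edge of $E_i$ lies below an endpoint of an edge of $E_j$ on some peg. Posets are considered up to isomorphism. Let $\mathrm{AllPosets}(W)=\{P(D):D\in W\}$ and $\mathrm{mult}_W(P)=|\{D\in W:P(D)\cong P\}|$. For a poset $P$ with elements labelled $1,\dots,|P|$ naturally ($i\prec j$ in $P$ implies $i<j$), let $\mathcal{L}(P)$ be the set of permutations $\pi$ listing the elements of $P$ in the order of some linear extension, and $\mathrm{des}(\pi)=|\{k:\pi_k>\pi_{k+1}\}|$.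 **Corollary 3.4.** Let $W$ be the web world of a web diagram with at least one edge, and suppose that every edge label of $G(W)$ equals $1$. Then each $D\in W$ has a decomposition poset $P(D)$, unique up to isomorphism, $\mathrm{AllPosets}(W)$ is finite, and, for every choice of a natural labelling of a representative of each isomorphism class, $$\operatorname{tr}M(x)=\sum_{D\in W}M(x)_{D,D}=\sum_{P\in\mathrm{AllPosets}(W)}\mathrm{mult}_W(P)\sum_{\pi\in\mathcal{L}(P)}x^{1+\mathrm{des}(\pi)}(1+x)^{|P|-1-\mathrm{des}(\pi)},$$ $$\operatorname{tr}R=\sum_{D\in W}R_{D,D}=\sum_{P\in\mathrm{AllPosets}(W)}\mathrm{mult}_W(P)\sum_{\pi\in\mathcal{L}(P)}\frac{(-1)^{\mathrm{des}(\pi)}}{|P|\binom{|P|-1}{\mathrm{des}(\pi)}}.$$ -/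

import Mathlib

namespace WebWorld

/-- An edge is a 4-tuple `(x, y, a, b)`: its left end lies on peg `x` at height `a`, its right end
on peg `y` at height `b`.  The `n` pegs are indexed by `Fin n`. -/
abbrev Edge (n : ℕ) := Fin n × Fin n × ℕ × ℕ

/-- The two endpoints of an edge, each given as a pair (peg, height). -/
def endpoints {n : ℕ} (e : Edge n) : Finset (Fin n × ℕ) :=
  {(e.1, e.2.2.1), (e.2.1, e.2.2.2)}

/-- `p_i(D)`: the number of edges of `D` incident with peg `i`. -/
def pegCount {n : ℕ} (D : Finset (Edge n)) (i : Fin n) : ℕ :=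
  (D.filter fun e => e.1 = i ∨ e.2.1 = i).card

/-- The set of heights of the endpoints of edges of `D` on peg `i`. -/
def heights {n : ℕ} (D : Finset (Edge n)) (i : Fin n) : Finset ℕ :=
  ((D.filter fun e => e.2.1 = i).image fun e => e.2.2.2) ∪
    ((D.filter fun e => e.1 = i).image fun e => e.2.2.1)

/-- Web diagrams on `n` pegs. -/
def IsWebDiagram {n : ℕ} (D : Finset (Edge n)) : Prop :=
  (∀ e ∈ D, e.1 < e.2.1) ∧ ∀ i : Fin n, heights D i = Finset.Icc 1 (pegCount D i)

/-- The pegs that carry at least one endpoint of `D`. -/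
def pegSet {n : ℕ} (D : Finset (Edge n)) : Finset (Fin n) :=
  D.image (fun e => e.1) ∪ D.image (fun e => e.2.1)

/-- Move every edge of `E` upwards: endpoints on peg `i` are raised by `s i`. -/
def shift {n : ℕ} (s : Fin n → ℕ) (E : Finset (Edge n)) : Finset (Edge n) :=
  E.image fun e => (e.1, e.2.1, e.2.2.1 + s e.1, e.2.2.2 + s e.2.1)

/-- The sum `D ⊕ E`: the diagram `E` placed on top of `D`. -/
def dsum {n : ℕ} (D E : Finset (Edge n)) : Finset (Edge n) :=
  D ∪ shift (pegCount D) E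

/-- The sum `E₁ ⊕ E₂ ⊕ ⋯ ⊕ E_k` of a list of diagrams. -/
def dsumList {n : ℕ} (Es : List (Finset (Edge n))) : Finset (Edge n) :=
  Es.foldl dsum ∅

/-- `rel(X)`: the heights on every peg are relabelled, preserving their order, by `1, 2, …`;
that is, every height is replaced by its rank among the heights of `X` on the same peg. -/
def rel {n : ℕ} (X : Finset (Edge n)) : Finset (Edge n) :=
  X.image fun e =>
    (e.1, e.2.1, ((heights X e.1).filter fun h => h ≤ e.2.2.1).card,
      ((heights X e.2.1).filter fun h => h ≤ e.2.2.2).card)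

/-- `π(D)`: the vertex at height `j` on peg `i` moves to height `π i j`. -/
def permute {n : ℕ} (D : Finset (Edge n))
    (π : (i : Fin n) → Equiv.Perm {h : ℕ // h ∈ Finset.Icc 1 (pegCount D i)}) :
    Finset (Edge n) :=
  D.image fun e =>
    (e.1, e.2.1, Equiv.Perm.ofSubtype (π e.1) e.2.2.1, Equiv.Perm.ofSubtype (π e.2.1) e.2.2.2)

/-- The web world `W(D)`. -/
def webWorld {n : ℕ} (D : Finset (Edge n)) : Finset (Finset (Edge n)) :=
  Finset.univ.image (permute D)

/-- The web graph (on the pegs that occur) of the web world of `D`. -/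
def webGraph {n : ℕ} (D : Finset (Edge n)) : SimpleGraph {i : Fin n // i ∈ pegSet D} :=
  SimpleGraph.fromRel fun i j => ∃ e ∈ D, e.1 = i.1 ∧ e.2.1 = j.1

/-- The label of an edge `{x, y}` of the web graph: the number of edges of `D` joining the pegs
`x` and `y`. -/
def webGraphLabel {n : ℕ} (D : Finset (Edge n)) (e : Sym2 {i : Fin n // i ∈ pegSet D}) : ℕ :=
  (D.filter fun d => s(d.1, d.2.1) = e.map Subtype.val).card

/-- `D_c(j)`: the edges of `D` that receive the colour `j`. -/
def colourClass {n ℓ : ℕ} (D : Finset (Edge n)) (c : {e : Edge n // e ∈ D} → Fin ℓ) (j : Fin ℓ) :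
    Finset (Edge n) :=
  (D.attach.filter fun e => c e = j).image Subtype.val

/-- The reconstruction of `D` according to the colouring `c`. -/
def recon {n ℓ : ℕ} (D : Finset (Edge n)) (c : {e : Edge n // e ∈ D} → Fin ℓ) :
    Finset (Edge n) :=
  dsumList (List.ofFn fun j : Fin ℓ => rel (colourClass D c j))

/-- `F(D₁, D₂, ℓ)`: the `ℓ`-colourings (surjections from the set of edges of `D₁` onto the set of
`ℓ` colours) whose reconstruction of `D₁` is `D₂`. -/
def colourings {n : ℕ} (D₁ D₂ : Finset (Edge n)) (ℓ : ℕ) :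
    Finset ({e : Edge n // e ∈ D₁} → Fin ℓ) :=
  Finset.univ.filter fun c => Function.Surjective c ∧ recon D₁ c = D₂

/-- `f(D₁, D₂, ℓ)`. -/
def numColourings {n : ℕ} (D₁ D₂ : Finset (Edge n)) (ℓ : ℕ) : ℕ :=
  (colourings D₁ D₂ ℓ).card

/-- The web-colouring matrix `M(x)`, with `x` an indeterminate.  An `ℓ`-colouring of `D₁` uses
`ℓ ≤ |D₁|` colours. -/
noncomputable def colouringMatrix {n : ℕ} (W : Finset (Finset (Edge n))) :
    Matrix {D // D ∈ W} {D // D ∈ W} (Polynomial ℚ) :=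
  fun D₁ D₂ => ∑ ℓ ∈ Finset.Icc 1 D₁.1.card,
    (Polynomial.X : Polynomial ℚ) ^ ℓ * (numColourings D₁.1 D₂.1 ℓ : Polynomial ℚ)

/-- The web-mixing matrix `R`. -/
def mixingMatrix {n : ℕ} (W : Finset (Finset (Edge n))) :
    Matrix {D // D ∈ W} {D // D ∈ W} ℚ :=
  fun D₁ D₂ => ∑ ℓ ∈ Finset.Icc 1 D₁.1.card,
    ((-1 : ℚ) ^ (ℓ - 1) / (ℓ : ℚ)) * (numColourings D₁.1 D₂.1 ℓ : ℚ)

/-- A finite poset whose elements are labelled `0, 1, …, size - 1` naturally: `i ≼ j` implies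
`i ≤ j`. -/
structure NaturalPoset where
  size : ℕ
  le : Fin size → Fin size → Prop
  le_refl : ∀ i, le i i
  le_trans : ∀ i j k, le i j → le j k → le i k
  natural : ∀ i j, le i j → i ≤ j

/-- Isomorphism of posets (regardless of the labellings). -/
instance posetSetoid : Setoid NaturalPoset where
  r P Q := Nonempty (P.le ≃r Q.le)
  iseqv :=
    { refl := fun P => ⟨RelIso.refl P.le⟩
      symm := fun ⟨f⟩ => ⟨f.symm⟩
      trans := fun ⟨f⟩ ⟨g⟩ => ⟨f.trans g⟩ }

/-- Isomorphism classes of finite posets (every finite poset has a natural labelling). -/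
abbrev PosetClass := Quotient posetSetoid

/-- The Jordan–Hölder set of `P`: permutations `π = π 0, π 1, …` of the elements of `P` for which
the map `π⁻¹`, from elements to positions, is order preserving. -/
noncomputable def jordanHolder (P : NaturalPoset) : Finset (Equiv.Perm (Fin P.size)) :=
  open Classical in
  Finset.univ.filter fun π => ∀ i j, P.le i j → π.symm i ≤ π.symm j

/-- The number of descents of a permutation. -/
def des {p : ℕ} (π : Equiv.Perm (Fin p)) : ℕ :=
  (Finset.univ.filter fun k : Fin p => ∃ h : k.1 + 1 < p, π ⟨k.1 + 1, h⟩ < π k).card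

/-- Indecomposable web diagrams (these are non-empty). -/
def IsIndecomposable {n : ℕ} (D : Finset (Edge n)) : Prop :=
  IsWebDiagram D ∧ D.Nonempty ∧
    ¬ ∃ E F : Finset (Edge n), IsWebDiagram E ∧ IsWebDiagram F ∧ E.Nonempty ∧ F.Nonempty ∧
      D = dsum E F

/-- `D = E₁ ⊕ ⋯ ⊕ E_k` with all `E_i` indecomposable. -/
def IsDecomposition {n : ℕ} (D : Finset (Edge n)) (Es : List (Finset (Edge n))) : Prop :=
  (∀ E ∈ Es, IsIndecomposable E) ∧ D = dsumList Es

/-- The edges of `E_i` in the positions that they occupy in `E₁ ⊕ ⋯ ⊕ E_k`. -/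
def block {n : ℕ} (Es : List (Finset (Edge n))) (i : Fin Es.length) : Finset (Edge n) :=
  shift (pegCount (dsumList (Es.take i.1))) (Es.get i)

/-- `i < j`, and some edge of `E_i` has an endpoint below an endpoint of an edge of `E_j` on some
peg of `E₁ ⊕ ⋯ ⊕ E_k`. -/
def IsBelow {n : ℕ} (Es : List (Finset (Edge n))) (i j : Fin Es.length) : Prop :=
  i < j ∧ ∃ e ∈ block Es i, ∃ e' ∈ block Es j, ∃ (q : Fin n) (h h' : ℕ),
    (q, h) ∈ endpoints e ∧ (q, h') ∈ endpoints e' ∧ h < h'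

/-- The poset on `E₁, …, E_k`: the partial order generated by the relation `IsBelow`. -/
def posetOfList {n : ℕ} (Es : List (Finset (Edge n))) : NaturalPoset where
  size := Es.length
  le := Relation.ReflTransGen (IsBelow Es)
  le_refl := fun _ => Relation.ReflTransGen.refl
  le_trans := fun _ _ _ h h' => h.trans h'
  natural := by
    intro i j h
    induction h with
    | refl => exact le_rfl
    | tail _ h ih => exact ih.trans h.1.le

/-- `P` is (the isomorphism class of) the decomposition poset `P(D)` of `D`. -/
def IsDecompositionPoset {n : ℕ} (D : Finset (Edge n)) (P : PosetClass) : Prop :=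
  ∃ Es : List (Finset (Edge n)), IsDecomposition D Es ∧ P = Quotient.mk posetSetoid (posetOfList Es)

/-- The set of all decomposition posets, up to isomorphism, of the diagrams in `W`. -/
def AllPosets {n : ℕ} (W : Finset (Finset (Edge n))) : Set PosetClass :=
  {P | ∃ D ∈ W, IsDecompositionPoset D P}

/-- The number of diagrams in `W` whose decomposition poset is `P`. -/
noncomputable def multip {n : ℕ} (W : Finset (Finset (Edge n))) (P : PosetClass) : ℕ :=
  Set.ncard {D | D ∈ W ∧ IsDecompositionPoset D P}

end WebWorld

open WebWorld Polynomial

/-! The reconstruction of `D` under a colouring `c` sorts the edges on each peg by colour and then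
by height (`Generic.colourSum_eq`). If `c` never decreases from an edge to one above it on a common
peg (the relation `Below`), this sort changes nothing. Conversely, when no two edges join the same
pair of pegs, a reconstruction equal to `D` must fix every single edge, so no pair on a peg is
inverted (`IsWebDiagram.colourSum_eq_self_iff`). Diagonal entries therefore count surjections onto a
chain that are monotone for the preorder generated by `Below`.

The antisymmetric quotient of that preorder is `P(D)`. A proper nonempty upper set of edges would
split a diagram as a sum, so each indecomposable block is strongly connected, while `Below` only
leads from a block to itself or a later one (`IsDecomposition.represents`). This also makes `P(D)`
unique, and the diagonal entry counts order-preserving surjections from `P(D)` onto a chain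
(`Represents.numColourings_eq`).

These are counted as in the theory of P-partitions. Stable sorting assigns to each surjection a
linear extension `π`, and what remains is a monotone surjection of chains that must increase at the
descents of `π`. Such a map is determined by its set of jumps, an arbitrary superset of the descent
set, which gives `x^(1+des π) (1+x)^(p-1-des π)` (`sum_card_chainSurjections`). The linear
functional `x^ℓ ↦ (-1)^(ℓ-1)/ℓ` turns the formula for `M` into the one for `R`, and grouping
diagrams by poset gives the traces. -/

namespace WebWorld

open Polynomial

/-! ### Monotone surjections between chains and their jump sets. -/

/-- The number of elements of `S` lying before `k`. -/
def countBelow {m : ℕ} (S : Finset (Fin m)) (k : Fin (m + 1)) : ℕ :=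
  (S.filter fun j => j.castSucc < k).card

lemma countBelow_zero {m : ℕ} (S : Finset (Fin m)) : countBelow S 0 = 0 := by
  simp [countBelow]

lemma countBelow_last {m : ℕ} (S : Finset (Fin m)) : countBelow S (Fin.last m) = S.card := by
  unfold countBelow
  rw [Finset.filter_true_of_mem]
  intro j _
  exact Fin.castSucc_lt_last j

lemma countBelow_succ {m : ℕ} (S : Finset (Fin m)) (k : Fin m) :
    countBelow S k.succ = countBelow S k.castSucc + if k ∈ S then 1 else 0 := by
  unfold countBelow
  have h : (S.filter fun j => j.castSucc < k.succ) =
      (S.filter fun j => j.castSucc < k.castSucc) ∪ (S.filter fun j => j = k) := by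
    ext j
    simp only [Finset.mem_filter, Finset.mem_union, Fin.castSucc_lt_succ_iff,
      Fin.castSucc_lt_castSucc_iff, le_iff_lt_or_eq]
    tauto
  rw [h, Finset.card_union_of_disjoint, Finset.filter_eq']
  · split_ifs <;> simp
  · rw [Finset.disjoint_left]
    intro j hj hj'
    simp only [Finset.mem_filter] at hj hj'
    rw [hj'.2] at hj
    exact lt_irrefl _ hj.2

lemma countBelow_mono {m : ℕ} (S : Finset (Fin m)) : Monotone (countBelow S) := by
  intro a b hab
  apply Finset.card_le_card
  intro j
  simp only [Finset.mem_filter]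
  exact fun h => ⟨h.1, h.2.trans_le hab⟩

/-- A discrete intermediate value theorem: the count starts at 0 and grows by at most 1 per step. -/
lemma exists_countBelow_eq {m : ℕ} (S : Finset (Fin m)) (k : Fin (m + 1)) :
    ∀ v ≤ countBelow S k, ∃ i, countBelow S i = v := by
  induction k using Fin.induction with
  | zero =>
    intro v hv
    rw [countBelow_zero] at hv
    exact ⟨0, by rw [countBelow_zero]; omega⟩
  | succ k ih =>
    intro v hv
    by_cases h : v = countBelow S k.succ
    · exact ⟨_, h.symm⟩
    · apply ih
      have := countBelow_succ S k
      split_ifs at this <;> omega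

/-- The positions at which `h` increases. -/
def jumpSet {m ℓ : ℕ} (h : Fin (m + 1) → Fin ℓ) : Finset (Fin m) :=
  Finset.univ.filter fun k => h k.castSucc < h k.succ

/-- Surjectivity forces `h` to start at 0 and every jump to be by exactly 1, since a skipped value
could not be attained elsewhere. -/
lemma val_eq_countBelow_jumpSet {m ℓ : ℕ} (h : Fin (m + 1) → Fin ℓ) (hm : Monotone h)
    (hs : Function.Surjective h) (k : Fin (m + 1)) : (h k : ℕ) = countBelow (jumpSet h) k := by
  induction k using Fin.induction with
  | zero =>
    rw [countBelow_zero]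
    obtain ⟨i, hi⟩ := hs ⟨0, (h 0).pos⟩
    have := hm (Fin.zero_le i)
    rw [hi] at this
    exact Nat.le_zero.mp this
  | succ k ih =>
    rw [countBelow_succ, ← ih]
    have hle : h k.castSucc ≤ h k.succ := hm (Fin.castSucc_le_succ k)
    split_ifs with hk
    · have hlt : h k.castSucc < h k.succ := by simpa [jumpSet] using hk
      by_contra hne
      have hlt' : (h k.castSucc : ℕ) + 1 < h k.succ := by
        have : (h k.castSucc : ℕ) < h k.succ := hlt
        omega
      obtain ⟨i, hi⟩ := hs ⟨(h k.castSucc : ℕ) + 1, hlt'.trans (h k.succ).isLt⟩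
      have hi' : (h i : ℕ) = (h k.castSucc : ℕ) + 1 := by rw [hi]
      rcases le_or_gt i k.castSucc with hik | hik
      · have : (h i : ℕ) ≤ h k.castSucc := hm hik
        omega
      · have : (h k.succ : ℕ) ≤ h i := hm (Fin.castSucc_lt_iff_succ_le.mp hik)
        omega
    · have : ¬ h k.castSucc < h k.succ := by simpa [jumpSet] using hk
      have := le_antisymm hle (not_lt.mp this)
      rw [← this, add_zero]

/-- Monotone surjections that increase at every position of `A`. -/
def monotoneSurjections {m : ℕ} (A : Finset (Fin m)) (ℓ : ℕ) : Finset (Fin (m + 1) → Fin ℓ) :=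
  Finset.univ.filter fun h => (∀ i j, i ≤ j → h i ≤ h j) ∧ Function.Surjective h ∧
    ∀ k ∈ A, h k.castSucc < h k.succ

lemma mem_monotoneSurjections {m ℓ : ℕ} {A : Finset (Fin m)} {h : Fin (m + 1) → Fin ℓ} :
    h ∈ monotoneSurjections A ℓ ↔ Monotone h ∧ Function.Surjective h ∧
      ∀ k ∈ A, h k.castSucc < h k.succ := by
  simp [monotoneSurjections, Monotone]

/-- The jump set determines the map, and `countBelow S` recovers the map from its jump set `S`. -/
lemma card_monotoneSurjections {m : ℕ} (A : Finset (Fin m)) (ℓ : ℕ) :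
    (monotoneSurjections A ℓ).card =
      ((Finset.univ.filter fun S : Finset (Fin m) => A ⊆ S).filter fun S => S.card + 1 = ℓ).card := by
  refine Finset.card_bij (fun h _ => jumpSet h) ?_ ?_ ?_
  · intro h hh
    obtain ⟨hm, hs, hA⟩ := mem_monotoneSurjections.mp hh
    simp only [Finset.mem_filter, Finset.mem_univ, true_and]
    refine ⟨fun k hk => by simpa [jumpSet] using hA k hk, ?_⟩
    rw [← countBelow_last, ← val_eq_countBelow_jumpSet h hm hs]
    have hpos := (h 0).pos
    -- The top colour is attained somewhere, hence at the last position.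
    obtain ⟨i, hi⟩ := hs ⟨ℓ - 1, by omega⟩
    have h1 : (h i : ℕ) ≤ h (Fin.last m) := hm (Fin.le_last i)
    have h2 : (h i : ℕ) = ℓ - 1 := by rw [hi]
    have h3 := (h (Fin.last m)).isLt
    omega
  · intro h hh h' hh' heq
    obtain ⟨hm, hs, -⟩ := mem_monotoneSurjections.mp hh
    obtain ⟨hm', hs', -⟩ := mem_monotoneSurjections.mp hh'
    funext k
    apply Fin.ext
    rw [val_eq_countBelow_jumpSet h hm hs, val_eq_countBelow_jumpSet h' hm' hs']
    exact congrArg (fun S => countBelow S k) heq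
  · intro S hS
    simp only [Finset.mem_filter, Finset.mem_univ, true_and] at hS
    obtain ⟨hA, rfl⟩ := hS
    have hlt : ∀ k, countBelow S k < S.card + 1 := by
      intro k
      rw [← countBelow_last]
      exact Nat.lt_succ_of_le (countBelow_mono S (Fin.le_last k))
    have hjump : ∀ k : Fin m, countBelow S k.castSucc < countBelow S k.succ ↔ k ∈ S := by
      intro k
      rw [countBelow_succ]
      split_ifs with hk <;> simp [hk]
    refine ⟨fun k => ⟨countBelow S k, hlt k⟩, ?_, ?_⟩
    · refine mem_monotoneSurjections.mpr ⟨fun a b hab => countBelow_mono S hab, ?_, ?_⟩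
      · rintro ⟨v, hv⟩
        obtain ⟨i, hi⟩ := exists_countBelow_eq S (Fin.last m) v (by rw [countBelow_last]; omega)
        exact ⟨i, Fin.ext hi⟩
      · intro k hk
        exact (hjump k).mpr (hA hk)
    · ext k
      simp only [jumpSet, Finset.mem_filter, Finset.mem_univ, true_and, Fin.mk_lt_mk]
      exact hjump k

/-- Expand a product over positions in which `i` contributes `x` if `i ∈ A` and `x + 1` otherwise;
the terms of the expansion that survive are the supersets of `A`. -/
lemma sum_superset_pow {R : Type*} [CommSemiring R] {m : ℕ} (A : Finset (Fin m)) (x : R) :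
    ∑ S ∈ Finset.univ.filter (fun S : Finset (Fin m) => A ⊆ S), x ^ (S.card + 1) =
      x ^ (1 + A.card) * (1 + x) ^ (m - A.card) := by
  have h := Finset.prod_add (fun _ : Fin m => x) (fun i => if i ∈ A then (0 : R) else 1)
    Finset.univ
  have hl : ∏ i : Fin m, (x + if i ∈ A then (0 : R) else 1) =
      x ^ A.card * (1 + x) ^ (m - A.card) := by
    rw [← Finset.prod_mul_prod_compl A]
    congr 1
    · rw [Finset.prod_congr rfl (g := fun _ => x), Finset.prod_const]
      intro i hi
      simp [hi]
    · rw [Finset.prod_congr rfl (g := fun _ => 1 + x), Finset.prod_const, Finset.card_compl,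
        Fintype.card_fin]
      intro i hi
      rw [Finset.mem_compl] at hi
      simp [hi, add_comm]
  have hr : ∀ S : Finset (Fin m),
      ((∏ _i ∈ S, x) * ∏ i ∈ Finset.univ \ S, if i ∈ A then (0 : R) else 1) =
        if A ⊆ S then x ^ S.card else 0 := by
    intro S
    rw [Finset.prod_const]
    split_ifs with hAS
    · rw [Finset.prod_eq_one, mul_one]
      intro i hi
      rw [if_neg]
      exact fun hiA => (Finset.mem_sdiff.mp hi).2 (hAS hiA)
    · obtain ⟨i, hiA, hiS⟩ := Finset.not_subset.mp hAS
      rw [Finset.prod_eq_zero (i := i), mul_zero]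
      · simp [hiS]
      · simp [hiA]
  rw [hl] at h
  rw [pow_add, mul_assoc, h, pow_one, Finset.mul_sum, Finset.powerset_univ, Finset.sum_filter]
  refine Finset.sum_congr rfl fun S _ => ?_
  rw [hr]
  split_ifs
  · rw [pow_succ, mul_comm]
  · simp

lemma sum_card_monotoneSurjections {m : ℕ} (A : Finset (Fin m)) (N : ℕ) (hN : m + 1 ≤ N) :
    ∑ ℓ ∈ Finset.Icc 1 N, (X : ℚ[X]) ^ ℓ * ((monotoneSurjections A ℓ).card : ℚ[X]) =
      X ^ (1 + A.card) * (1 + X) ^ (m - A.card) := by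
  rw [← sum_superset_pow, ← Finset.sum_fiberwise_of_maps_to
    (g := fun S : Finset (Fin m) => S.card + 1) (t := Finset.Icc 1 N)]
  · refine Finset.sum_congr rfl fun ℓ _ => ?_
    rw [card_monotoneSurjections, Finset.sum_congr rfl (g := fun _ => (X : ℚ[X]) ^ ℓ),
      Finset.sum_const, nsmul_eq_mul, mul_comm]
    intro S hS
    rw [(Finset.mem_filter.mp hS).2]
  · intro S _
    have : S.card ≤ m := by simpa using S.card_le_univ
    rw [Finset.mem_Icc]
    omega

/-! ### Order-preserving surjections from a poset onto a chain. -/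

/-- The descent positions of a permutation. -/
def descentSet {m : ℕ} (π : Equiv.Perm (Fin (m + 1))) : Finset (Fin m) :=
  Finset.univ.filter fun k => π k.succ < π k.castSucc

lemma card_descentSet {m : ℕ} (π : Equiv.Perm (Fin (m + 1))) : (descentSet π).card = des π := by
  refine Finset.card_bij (fun k _ => k.castSucc) ?_ ?_ ?_
  · intro k hk
    simp only [descentSet, Finset.mem_filter, Finset.mem_univ, true_and] at hk ⊢
    exact ⟨by simp, hk⟩
  · intro a _ b _ hab
    exact Fin.castSucc_injective m hab
  · intro k hk
    simp only [Finset.mem_filter, Finset.mem_univ, true_and] at hk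
    obtain ⟨hk, hlt⟩ := hk
    refine ⟨⟨k.1, by omega⟩, ?_, rfl⟩
    simp only [descentSet, Finset.mem_filter, Finset.mem_univ, true_and]
    exact hlt

/-- Surjective order-preserving maps onto a chain. -/
noncomputable def chainSurjections (P : NaturalPoset) (ℓ : ℕ) : Finset (Fin P.size → Fin ℓ) :=
  open Classical in
  Finset.univ.filter fun g => Function.Surjective g ∧ ∀ i j, P.le i j → g i ≤ g j

lemma mem_chainSurjections {P : NaturalPoset} {ℓ : ℕ} {g : Fin P.size → Fin ℓ} :
    g ∈ chainSurjections P ℓ ↔ Function.Surjective g ∧ ∀ i j, P.le i j → g i ≤ g j := by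
  simp [chainSurjections]

lemma mem_jordanHolder {P : NaturalPoset} {π : Equiv.Perm (Fin P.size)} :
    π ∈ jordanHolder P ↔ ∀ i j, P.le i j → π.symm i ≤ π.symm j := by
  simp [jordanHolder]

/-- `Tuple.sort` breaks ties by label, and the labelling is natural, so comparable elements with
equal values are still listed in order. -/
lemma sort_mem_jordanHolder {P : NaturalPoset} {ℓ : ℕ} {g : Fin P.size → Fin ℓ}
    (hg : g ∈ chainSurjections P ℓ) : Tuple.sort g ∈ jordanHolder P := by
  rw [mem_jordanHolder]
  intro i j hij
  by_contra hlt
  rw [not_le] at hlt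
  obtain ⟨hm, hst⟩ := Tuple.eq_sort_iff.mp (rfl : Tuple.sort g = Tuple.sort g)
  have h1 := hm hlt.le
  simp only [Function.comp_apply, Equiv.apply_symm_apply] at h1
  have h2 := (mem_chainSurjections.mp hg).2 i j hij
  have h3 := hst _ _ hlt
  simp only [Equiv.apply_symm_apply] at h3
  exact absurd (h3 (le_antisymm h1 h2)) (not_lt.mpr (P.natural i j hij))

/-- Stability requires `π` to increase on each level set of `g ∘ π`. Level sets are intervals, so
adjacent positions suffice: no descent may lie inside one. -/
lemma sort_eq_iff_descent {m ℓ : ℕ} (g : Fin (m + 1) → Fin ℓ) (π : Equiv.Perm (Fin (m + 1))) :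
    Tuple.sort g = π ↔ Monotone (g ∘ π) ∧
      ∀ k ∈ descentSet π, (g ∘ π) k.castSucc < (g ∘ π) k.succ := by
  rw [eq_comm, Tuple.eq_sort_iff]
  refine and_congr_right fun hm => ⟨fun h k hk => ?_, fun h i j hij heq => ?_⟩
  · refine lt_of_le_of_ne (hm (Fin.castSucc_le_succ k)) fun heq => ?_
    have := h k.castSucc k.succ (Fin.castSucc_lt_succ) heq
    simp only [descentSet, Finset.mem_filter, Finset.mem_univ, true_and] at hk
    exact lt_asymm this hk
  · induction j using Fin.induction with
    | zero => exact absurd hij (Fin.not_lt_zero i)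
    | succ k ih =>
      have hik : i ≤ k.castSucc := Fin.le_castSucc_iff.mpr hij
      have h1 : g (π i) ≤ g (π k.castSucc) := hm hik
      have h2 : g (π k.castSucc) ≤ g (π k.succ) := hm (Fin.castSucc_le_succ k)
      have hstep : π k.castSucc < π k.succ := by
        refine lt_of_le_of_ne (not_lt.mp fun hlt => ?_) fun hne => ?_
        · have := h k (by simpa [descentSet] using hlt)
          simp only [Function.comp_apply] at this
          exact absurd (this.trans_le (heq ▸ h1)) (lt_irrefl _)
        · exact (Fin.castSucc_lt_succ (i := k)).ne (π.injective hne)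
      rcases hik.eq_or_lt with rfl | hlt
      · exact hstep
      · exact (ih hlt (le_antisymm h1 (heq ▸ h2))).trans hstep

/-- The fibre of `Tuple.sort` over `π` corresponds, via `g ↦ g ∘ π`, to the monotone surjections
that increase at the descents of `π`. -/
lemma sum_card_chainSurjections (P : NaturalPoset) (hP : 0 < P.size) (N : ℕ) (hN : P.size ≤ N) :
    ∑ ℓ ∈ Finset.Icc 1 N, (X : ℚ[X]) ^ ℓ * ((chainSurjections P ℓ).card : ℚ[X]) =
      ∑ π ∈ jordanHolder P, (X : ℚ[X]) ^ (1 + des π) * (1 + X) ^ (P.size - 1 - des π) := by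
  obtain ⟨p, le, hr, ht, hn⟩ := P
  obtain ⟨m, rfl⟩ : ∃ m, p = m + 1 := ⟨p - 1, by simp only at hP; omega⟩
  set P : NaturalPoset := ⟨m + 1, le, hr, ht, hn⟩ with hPdef
  have key : ∀ ℓ, (chainSurjections P ℓ).card =
      ∑ π ∈ jordanHolder P, (monotoneSurjections (descentSet (m := m) π) ℓ).card := by
    intro ℓ
    rw [Finset.card_eq_sum_card_fiberwise (f := Tuple.sort) (t := jordanHolder P)
      fun g hg => sort_mem_jordanHolder hg]
    refine Finset.sum_congr rfl fun π hπ => ?_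
    rw [mem_jordanHolder] at hπ
    refine Finset.card_bij (fun g _ => g ∘ π) ?_ ?_ ?_
    · intro g hg
      rw [Finset.mem_filter, mem_chainSurjections] at hg
      obtain ⟨hm, hd⟩ := (sort_eq_iff_descent (m := m) g π).mp hg.2
      exact mem_monotoneSurjections.mpr ⟨hm, hg.1.1.comp π.surjective, hd⟩
    · intro a _ b _ hab
      exact π.surjective.injective_comp_right hab
    · intro h hh
      obtain ⟨hm, hs, hd⟩ := mem_monotoneSurjections.mp hh
      have hcomp : (h ∘ π.symm) ∘ π = h := by
        funext k
        exact congrArg h (π.symm_apply_apply k)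
      refine ⟨h ∘ π.symm, ?_, hcomp⟩
      rw [Finset.mem_filter, mem_chainSurjections]
      refine ⟨⟨hs.comp π.symm.surjective, fun i j hij => hm (hπ i j hij)⟩, ?_⟩
      rw [sort_eq_iff_descent (m := m), hcomp]
      exact ⟨hm, hd⟩
  simp only [key, Nat.cast_sum, Finset.mul_sum]
  rw [Finset.sum_comm]
  refine Finset.sum_congr rfl fun π _ => ?_
  rw [sum_card_monotoneSurjections _ _ hN, card_descentSet]
  rfl

/-! ### The functional that turns the colouring polynomial into the mixing coefficient. -/

/-- The linear functional sending `X ^ ℓ` to `(-1) ^ (ℓ - 1) / ℓ`, i.e. integrating `p / X` from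
`-1` to `0`. -/
noncomputable def mixingFunctional : ℚ[X] →ₗ[ℚ] ℚ :=
  Polynomial.lsum fun ℓ => ((-1 : ℚ) ^ (ℓ - 1) / ℓ) • LinearMap.id

lemma mixingFunctional_pow (ℓ : ℕ) :
    mixingFunctional (X ^ ℓ) = (-1 : ℚ) ^ (ℓ - 1) / ℓ := by
  rw [← Polynomial.monomial_one_right_eq_X_pow]
  simp [mixingFunctional, Polynomial.lsum_apply, Polynomial.sum_monomial_index]

lemma mixingFunctional_pow_mul_natCast (ℓ k : ℕ) :
    mixingFunctional (X ^ ℓ * (k : ℚ[X])) = (-1 : ℚ) ^ (ℓ - 1) / ℓ * k := by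
  rw [mul_comm, ← nsmul_eq_mul, map_nsmul, mixingFunctional_pow, nsmul_eq_mul, mul_comm]

/-- A Beta integral in disguise, evaluated by induction on `m` by splitting one factor `1 + X`. -/
lemma mixingFunctional_pow_mul_pow (d m : ℕ) :
    mixingFunctional (X ^ (1 + d) * (1 + X) ^ m) =
      (-1 : ℚ) ^ d / (((d + m + 1 : ℕ) : ℚ) * ((d + m).choose d : ℚ)) := by
  induction m generalizing d with
  | zero => simp [mixingFunctional_pow, add_comm]
  | succ m ih =>
    have hsplit : (X : ℚ[X]) ^ (1 + d) * (1 + X) ^ (m + 1) =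
        X ^ (1 + d) * (1 + X) ^ m + X ^ (1 + (d + 1)) * (1 + X) ^ m := by ring
    rw [hsplit, map_add, ih, ih]
    -- `h1` and `h2` express both other binomials through `(d + m).choose d`, leaving a rational
    -- identity.
    have h1 : ((d + 1 + m).choose (d + 1) : ℚ) * (d + 1) = (d + m + 1) * (d + m).choose d := by
      have := Nat.add_one_mul_choose_eq (d + m) d
      rw [show d + 1 + m = d + m + 1 by ring]
      exact_mod_cast this.symm
    have h2 : ((d + (m + 1)).choose d : ℚ) * (m + 1) = (d + m + 1) * (d + m).choose d := by
      have := Nat.choose_mul_succ_eq (d + m) d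
      rw [show d + m + 1 - d = m + 1 by omega] at this
      rw [show d + (m + 1) = d + m + 1 by ring, mul_comm ((d : ℚ) + m + 1)]
      exact_mod_cast this.symm
    have hc : ((d + m).choose d : ℚ) ≠ 0 := by
      exact_mod_cast (Nat.choose_pos (Nat.le_add_right d m)).ne'
    have hd : ((d : ℚ) + 1) ≠ 0 := by positivity
    have hm : ((m : ℚ) + 1) ≠ 0 := by positivity
    have hdm : ((d : ℚ) + m + 1) ≠ 0 := by positivity
    have hdm2 : ((d : ℚ) + m + 2) ≠ 0 := by positivity
    rw [eq_div_of_mul_eq hd h1, eq_div_of_mul_eq hm h2]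
    push_cast
    rw [show (d : ℚ) + 1 + m + 1 = d + m + 2 by ring, show (d : ℚ) + (m + 1) + 1 = d + m + 2 by ring]
    field_simp
    ring

lemma des_lt {p : ℕ} (hp : 0 < p) (π : Equiv.Perm (Fin p)) : des π < p := by
  obtain ⟨m, rfl⟩ : ∃ m, p = m + 1 := ⟨p - 1, by omega⟩
  rw [← card_descentSet]
  exact Nat.lt_succ_of_le (by simpa using (descentSet π).card_le_univ)

lemma mixingFunctional_chain_polynomial {p : ℕ} (hp : 0 < p) (π : Equiv.Perm (Fin p)) :
    mixingFunctional (X ^ (1 + des π) * (1 + X) ^ (p - 1 - des π)) =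
      (-1 : ℚ) ^ des π / (p * ((p - 1).choose (des π) : ℚ)) := by
  have := des_lt hp π
  rw [mixingFunctional_pow_mul_pow, show des π + (p - 1 - des π) = p - 1 by omega,
    show p - 1 + 1 = p by omega]

end WebWorld

/-! ### Heights on pegs, relabelling, and sums of web diagrams. -/

namespace WebWorld

variable {n : ℕ}

/-- The edge `e` is incident with the peg `q`. -/
abbrev Meets (q : Fin n) (e : Edge n) : Prop := e.1 = q ∨ e.2.1 = q

/-- The height of `e` on an incident peg `q`. -/
def heightOn (q : Fin n) (e : Edge n) : ℕ := if e.1 = q then e.2.2.1 else e.2.2.2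

/-- The edges of `X` that are incident with the peg `q`. -/
def atPeg (X : Finset (Edge n)) (q : Fin n) : Finset (Edge n) := X.filter (Meets q)

lemma pegCount_eq (X : Finset (Edge n)) (q : Fin n) : pegCount X q = (atPeg X q).card := rfl

lemma mem_atPeg {X : Finset (Edge n)} {q : Fin n} {e : Edge n} :
    e ∈ atPeg X q ↔ e ∈ X ∧ Meets q e := by simp [atPeg]

lemma atPeg_filter (X : Finset (Edge n)) (p : Edge n → Prop) [DecidablePred p] (q : Fin n) :
    atPeg (X.filter p) q = (atPeg X q).filter p := by
  ext e
  simp only [mem_atPeg, Finset.mem_filter]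
  tauto

lemma atPeg_image {X : Finset (Edge n)} {φ : Edge n → Edge n}
    (hφ : ∀ e, (φ e).1 = e.1 ∧ (φ e).2.1 = e.2.1) (q : Fin n) :
    atPeg (X.image φ) q = (atPeg X q).image φ := by
  ext e
  simp only [mem_atPeg, Finset.mem_image]
  constructor
  · rintro ⟨⟨a, ha, rfl⟩, hq⟩
    rw [Meets, (hφ a).1, (hφ a).2] at hq
    exact ⟨a, ⟨ha, hq⟩, rfl⟩
  · rintro ⟨a, ⟨ha, hq⟩, rfl⟩
    refine ⟨⟨a, ha, rfl⟩, ?_⟩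
    rw [Meets, (hφ a).1, (hφ a).2]
    exact hq

lemma heightOn_left (e : Edge n) : heightOn e.1 e = e.2.2.1 := by simp [heightOn]

lemma heightOn_right {e : Edge n} (he : e.1 < e.2.1) : heightOn e.2.1 e = e.2.2.2 := by
  simp [heightOn, he.ne]

lemma mem_endpoints_iff {e : Edge n} (he : e.1 < e.2.1) {q : Fin n} {h : ℕ} :
    (q, h) ∈ endpoints e ↔ Meets q e ∧ h = heightOn q e := by
  simp only [endpoints, Finset.mem_insert, Finset.mem_singleton, Prod.mk.injEq]
  constructor
  · rintro (⟨rfl, rfl⟩ | ⟨rfl, rfl⟩)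
    · exact ⟨Or.inl rfl, (heightOn_left e).symm⟩
    · exact ⟨Or.inr rfl, (heightOn_right he).symm⟩
  · rintro ⟨rfl | rfl, rfl⟩
    · exact Or.inl ⟨rfl, heightOn_left e⟩
    · exact Or.inr ⟨rfl, heightOn_right he⟩

lemma heights_eq_image {X : Finset (Edge n)} (hX : ∀ e ∈ X, e.1 < e.2.1) (q : Fin n) :
    heights X q = (atPeg X q).image (heightOn q) := by
  ext h
  simp only [heights, Finset.mem_union, Finset.mem_image, Finset.mem_filter, mem_atPeg]
  constructor
  · rintro (⟨e, ⟨he, rfl⟩, rfl⟩ | ⟨e, ⟨he, rfl⟩, rfl⟩)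
    · exact ⟨e, ⟨he, Or.inr rfl⟩, heightOn_right (hX e he)⟩
    · exact ⟨e, ⟨he, Or.inl rfl⟩, heightOn_left e⟩
  · rintro ⟨e, ⟨he, rfl | rfl⟩, rfl⟩
    · exact Or.inr ⟨e, ⟨he, rfl⟩, (heightOn_left e).symm⟩
    · exact Or.inl ⟨e, ⟨he, rfl⟩, (heightOn_right (hX e he)).symm⟩

lemma left_mem_heights {X : Finset (Edge n)} {e : Edge n} (he : e ∈ X) :
    e.2.2.1 ∈ heights X e.1 :=
  Finset.mem_union_right _ (Finset.mem_image.mpr ⟨e, by simp [he], rfl⟩)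

lemma right_mem_heights {X : Finset (Edge n)} {e : Edge n} (he : e ∈ X) :
    e.2.2.2 ∈ heights X e.2.1 :=
  Finset.mem_union_left _ (Finset.mem_image.mpr ⟨e, by simp [he], rfl⟩)

/-- Edges go from left to right, and different edges have different heights on every peg. -/
structure Generic (X : Finset (Edge n)) : Prop where
  lt : ∀ e ∈ X, e.1 < e.2.1
  inj : ∀ q, ∀ e ∈ X, ∀ e' ∈ X, Meets q e → Meets q e' → heightOn q e = heightOn q e' → e = e'

/-- The reason for `Generic`: a colour class of a web diagram need not be a web diagram, but it
inherits this weaker property. -/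
lemma Generic.mono {X Y : Finset (Edge n)} (hY : Generic Y) (h : X ⊆ Y) : Generic X :=
  ⟨fun e he => hY.lt e (h he), fun q e he e' he' => hY.inj q e (h he) e' (h he')⟩

lemma Generic.injOn {X : Finset (Edge n)} (hX : Generic X) (q : Fin n) :
    Set.InjOn (heightOn q) (atPeg X q) := by
  intro e he e' he' h
  rw [Finset.mem_coe, mem_atPeg] at he he'
  exact hX.inj q e he.1 e' he'.1 he.2 he'.2 h

lemma IsWebDiagram.generic {D : Finset (Edge n)} (hD : IsWebDiagram D) : Generic D := by
  refine ⟨hD.1, fun q e he e' he' hq hq' h => ?_⟩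
  have hinj : Set.InjOn (heightOn q) (atPeg D q) := by
    rw [← Finset.card_image_iff, ← heights_eq_image hD.1, hD.2 q, Nat.card_Icc, pegCount_eq]
    rfl
  exact hinj (Finset.mem_coe.mpr (mem_atPeg.mpr ⟨he, hq⟩))
    (Finset.mem_coe.mpr (mem_atPeg.mpr ⟨he', hq'⟩)) h

lemma IsWebDiagram.heightOn_mem {D : Finset (Edge n)} (hD : IsWebDiagram D) {q : Fin n}
    {e : Edge n} (he : e ∈ D) (hq : Meets q e) : heightOn q e ∈ Finset.Icc 1 (pegCount D q) := by
  rw [← hD.2 q, heights_eq_image hD.1]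
  exact Finset.mem_image_of_mem _ (mem_atPeg.mpr ⟨he, hq⟩)

/-- The heights on a peg fill an initial interval without repetition, so a height is its own rank.
-/
lemma IsWebDiagram.card_le_heightOn {D : Finset (Edge n)} (hD : IsWebDiagram D) {q : Fin n}
    {e : Edge n} (he : e ∈ D) (hq : Meets q e) :
    ((atPeg D q).filter fun e' => heightOn q e' ≤ heightOn q e).card = heightOn q e := by
  rw [← Finset.card_image_of_injOn ((hD.generic.injOn q).mono
    (Finset.coe_subset.mpr (Finset.filter_subset _ _)))]
  have himg : ((atPeg D q).filter fun e' => heightOn q e' ≤ heightOn q e).image (heightOn q) =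
      Finset.Icc 1 (heightOn q e) := by
    have h1 := hD.heightOn_mem he hq
    rw [Finset.mem_Icc] at h1
    have himg' := Finset.filter_image (s := atPeg D q) (f := heightOn q)
      (p := fun h => h ≤ heightOn q e)
    rw [← heights_eq_image hD.1, hD.2 q] at himg'
    refine himg'.symm.trans ?_
    ext h
    simp only [Finset.mem_filter, Finset.mem_Icc]
    omega
  rw [himg, Nat.card_Icc]
  rfl

/-- Change the heights on every peg `q` by `H q`. -/
def relabelEdge (H : Fin n → ℕ → ℕ) (e : Edge n) : Edge n :=
  (e.1, e.2.1, H e.1 e.2.2.1, H e.2.1 e.2.2.2)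

lemma heightOn_relabelEdge (H : Fin n → ℕ → ℕ) {q : Fin n} {e : Edge n} (hq : Meets q e) :
    heightOn q (relabelEdge H e) = H q (heightOn q e) := by
  unfold heightOn relabelEdge
  by_cases h : e.1 = q
  · simp [h]
  · have : e.2.1 = q := hq.resolve_left h
    simp [h, this]

lemma heights_relabel (H : Fin n → ℕ → ℕ) (X : Finset (Edge n)) (q : Fin n) :
    heights (X.image (relabelEdge H)) q = (heights X q).image (H q) := by
  ext h
  simp only [heights, Finset.mem_union, Finset.mem_image, Finset.mem_filter]
  constructor
  · rintro (⟨_, ⟨⟨e, he, rfl⟩, rfl⟩, rfl⟩ | ⟨_, ⟨⟨e, he, rfl⟩, rfl⟩, rfl⟩)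
    · exact ⟨e.2.2.2, Or.inl ⟨e, ⟨he, rfl⟩, rfl⟩, rfl⟩
    · exact ⟨e.2.2.1, Or.inr ⟨e, ⟨he, rfl⟩, rfl⟩, rfl⟩
  · rintro ⟨_, ⟨e, ⟨he, rfl⟩, rfl⟩ | ⟨e, ⟨he, rfl⟩, rfl⟩, rfl⟩
    · exact Or.inl ⟨_, ⟨⟨e, he, rfl⟩, rfl⟩, rfl⟩
    · exact Or.inr ⟨_, ⟨⟨e, he, rfl⟩, rfl⟩, rfl⟩

lemma relabelEdge_injOn {H : Fin n → ℕ → ℕ} {X : Finset (Edge n)}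
    (hH : ∀ q, Set.InjOn (H q) (heights X q)) : Set.InjOn (relabelEdge H) X := by
  intro e he e' he' h
  simp only [relabelEdge, Prod.mk.injEq] at h
  obtain ⟨hx, hy, h1, h2⟩ := h
  have hl := left_mem_heights he'
  have hr := right_mem_heights he'
  rw [← hx] at h1 hl
  rw [← hy] at h2 hr
  exact Prod.ext hx (Prod.ext hy (Prod.ext (hH _ (left_mem_heights he) hl h1)
    (hH _ (right_mem_heights he) hr h2)))

lemma pegCount_image {X : Finset (Edge n)} {φ : Edge n → Edge n}
    (hφ : ∀ e, (φ e).1 = e.1 ∧ (φ e).2.1 = e.2.1) (hinj : Set.InjOn φ X) (q : Fin n) :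
    pegCount (X.image φ) q = pegCount X q := by
  rw [pegCount_eq, pegCount_eq, atPeg_image hφ, Finset.card_image_of_injOn]
  exact hinj.mono (Finset.coe_subset.mpr (Finset.filter_subset _ _))

lemma pegCount_relabel {H : Fin n → ℕ → ℕ} {X : Finset (Edge n)}
    (hH : ∀ q, Set.InjOn (H q) (heights X q)) (q : Fin n) :
    pegCount (X.image (relabelEdge H)) q = pegCount X q :=
  pegCount_image (φ := relabelEdge H) (fun _ => ⟨rfl, rfl⟩) (relabelEdge_injOn hH) q

/-- Serves both `rel` and `permute`, which are by definition relabellings of this kind. -/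
lemma isWebDiagram_relabel {H : Fin n → ℕ → ℕ} {X : Finset (Edge n)}
    (hX : ∀ e ∈ X, e.1 < e.2.1) (hH : ∀ q, Set.InjOn (H q) (heights X q))
    (himg : ∀ q, (heights X q).image (H q) = Finset.Icc 1 (pegCount X q)) :
    IsWebDiagram (X.image (relabelEdge H)) := by
  refine ⟨?_, fun q => ?_⟩
  · intro e he
    obtain ⟨a, ha, rfl⟩ := Finset.mem_image.mp he
    exact hX a ha
  · rw [heights_relabel, pegCount_relabel hH, himg]

lemma card_filter_le_strictMonoOn (A : Finset ℕ) :
    StrictMonoOn (fun h => (A.filter fun a => a ≤ h).card) A := by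
  intro a _ b hb hab
  apply Finset.card_lt_card
  refine ⟨fun x hx => ?_, fun h => ?_⟩
  · rw [Finset.mem_filter] at hx ⊢
    exact ⟨hx.1, hx.2.trans hab.le⟩
  · have := h (Finset.mem_filter.mpr ⟨hb, le_rfl⟩)
    exact absurd (Finset.mem_filter.mp this).2 (not_le.mpr hab)

lemma image_card_filter_le (A : Finset ℕ) :
    A.image (fun h => (A.filter fun a => a ≤ h).card) = Finset.Icc 1 A.card := by
  apply Finset.eq_of_subset_of_card_le
  · intro x hx
    obtain ⟨h, hh, rfl⟩ := Finset.mem_image.mp hx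
    rw [Finset.mem_Icc]
    exact ⟨Finset.card_pos.mpr ⟨h, Finset.mem_filter.mpr ⟨hh, le_rfl⟩⟩,
      Finset.card_le_card (Finset.filter_subset _ _)⟩
  · rw [Finset.card_image_of_injOn (card_filter_le_strictMonoOn A).injOn, Nat.card_Icc]
    rfl

lemma Generic.card_heights {X : Finset (Edge n)} (hX : Generic X) (q : Fin n) :
    (heights X q).card = pegCount X q := by
  rw [heights_eq_image hX.lt, Finset.card_image_of_injOn (hX.injOn q), pegCount_eq]

lemma Generic.isWebDiagram_rel {X : Finset (Edge n)} (hX : Generic X) : IsWebDiagram (rel X) := by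
  refine isWebDiagram_relabel (H := fun q h => ((heights X q).filter fun a => a ≤ h).card)
    hX.lt (fun q => (card_filter_le_strictMonoOn _).injOn) fun q => ?_
  rw [image_card_filter_le, hX.card_heights]

lemma shift_eq (s : Fin n → ℕ) (E : Finset (Edge n)) :
    shift s E = E.image (relabelEdge fun q h => h + s q) := rfl

lemma pegCount_shift (s : Fin n → ℕ) (E : Finset (Edge n)) (q : Fin n) :
    pegCount (shift s E) q = pegCount E q :=
  pegCount_relabel (fun _ => (add_left_injective _).injOn) q

lemma shift_zero (E : Finset (Edge n)) : shift (fun _ => 0) E = E := by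
  simp [shift]

lemma empty_dsum (E : Finset (Edge n)) : dsum ∅ E = E := by
  rw [dsum, Finset.empty_union]
  exact shift_zero E

lemma dsum_empty (E : Finset (Edge n)) : dsum E ∅ = E := by
  simp [dsum, shift]

lemma isWebDiagram_empty : IsWebDiagram (∅ : Finset (Edge n)) := by
  simp [IsWebDiagram, heights, pegCount]

section dsum

variable {D E : Finset (Edge n)}

lemma IsWebDiagram.disjoint_shift (hD : IsWebDiagram D) (hE : IsWebDiagram E) :
    Disjoint D (shift (pegCount D) E) := by
  rw [Finset.disjoint_left]
  intro e he he'
  have h1 := left_mem_heights he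
  have h2 := left_mem_heights he'
  rw [hD.2, Finset.mem_Icc] at h1
  rw [shift_eq, heights_relabel, hE.2, Finset.mem_image] at h2
  obtain ⟨h, hh, heq⟩ := h2
  rw [Finset.mem_Icc] at hh
  omega

lemma IsWebDiagram.pegCount_dsum (hD : IsWebDiagram D) (hE : IsWebDiagram E) (q : Fin n) :
    pegCount (dsum D E) q = pegCount D q + pegCount E q := by
  rw [← pegCount_shift (pegCount D) E q, dsum, pegCount, Finset.filter_union,
    Finset.card_union_of_disjoint]
  · rfl
  · exact Finset.disjoint_filter_filter (hD.disjoint_shift hE)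

lemma IsWebDiagram.card_dsum (hD : IsWebDiagram D) (hE : IsWebDiagram E) :
    (dsum D E).card = D.card + E.card := by
  rw [dsum, Finset.card_union_of_disjoint (hD.disjoint_shift hE), shift_eq,
    Finset.card_image_of_injOn (relabelEdge_injOn fun _ => (add_left_injective _).injOn)]

lemma heights_union (X Y : Finset (Edge n)) (q : Fin n) :
    heights (X ∪ Y) q = heights X q ∪ heights Y q := by
  ext h
  simp only [heights, Finset.filter_union, Finset.image_union, Finset.mem_union]
  tauto

lemma IsWebDiagram.dsum (hD : IsWebDiagram D) (hE : IsWebDiagram E) :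
    IsWebDiagram (dsum D E) := by
  refine ⟨?_, fun q => ?_⟩
  · intro e he
    rcases Finset.mem_union.mp he with he | he
    · exact hD.1 e he
    · obtain ⟨a, ha, rfl⟩ := Finset.mem_image.mp he
      exact hE.1 a ha
  · rw [hD.pegCount_dsum hE, WebWorld.dsum, heights_union, shift_eq, heights_relabel, hD.2, hE.2]
    ext h
    simp only [Finset.mem_union, Finset.mem_Icc, Finset.mem_image]
    constructor
    · rintro (h1 | ⟨a, h1, rfl⟩) <;> omega
    · intro h1
      by_cases h2 : h ≤ pegCount D q
      · exact Or.inl ⟨h1.1, h2⟩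
      · exact Or.inr ⟨h - pegCount D q, by omega, by omega⟩

lemma IsWebDiagram.dsum_assoc (hD : IsWebDiagram D) (hE : IsWebDiagram E) (F : Finset (Edge n)) :
    WebWorld.dsum (WebWorld.dsum D E) F = WebWorld.dsum D (WebWorld.dsum E F) := by
  have h : pegCount (WebWorld.dsum D E) = fun q => pegCount D q + pegCount E q :=
    funext fun q => hD.pegCount_dsum hE q
  conv_lhs => rw [WebWorld.dsum, h]
  simp only [WebWorld.dsum, shift, Finset.image_union, Finset.image_image, Finset.union_assoc]
  congr 2
  refine Finset.image_congr fun e _ => ?_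
  simp only [Function.comp_apply, Prod.mk.injEq, true_and]
  constructor <;> ring

end dsum

lemma dsumList_append_singleton (Es : List (Finset (Edge n))) (E : Finset (Edge n)) :
    dsumList (Es ++ [E]) = dsum (dsumList Es) E := by
  simp [dsumList]

lemma isWebDiagram_dsumList (Es : List (Finset (Edge n))) (h : ∀ E ∈ Es, IsWebDiagram E) :
    IsWebDiagram (dsumList Es) := by
  induction Es using List.reverseRecOn with
  | nil => exact isWebDiagram_empty
  | append_singleton Es E ih =>
    rw [dsumList_append_singleton]
    exact (ih fun E hE => h E (by simp [hE])).dsum (h E (by simp))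

lemma dsumList_append (Es Fs : List (Finset (Edge n))) (hE : ∀ E ∈ Es, IsWebDiagram E)
    (hF : ∀ E ∈ Fs, IsWebDiagram E) :
    dsumList (Es ++ Fs) = dsum (dsumList Es) (dsumList Fs) := by
  induction Fs using List.reverseRecOn with
  | nil => simp [dsumList, dsum_empty]
  | append_singleton Fs F ih =>
    have hF' : ∀ E ∈ Fs, IsWebDiagram E := fun E hE => hF E (by simp [hE])
    rw [← List.append_assoc, dsumList_append_singleton, dsumList_append_singleton, ih hF',
      IsWebDiagram.dsum_assoc (isWebDiagram_dsumList Es hE) (isWebDiagram_dsumList Fs hF')]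

/-! ### Reconstruction as sorting by colour, then height. -/

section colour

variable (D : Finset (Edge n)) (c : Edge n → ℕ)

/-- The position of `e` on the peg `q` when edges are sorted by colour and then by height. -/
def colourHeight (q : Fin n) (e : Edge n) : ℕ :=
  ((atPeg D q).filter fun e' => c e' < c e ∨ c e' = c e ∧ heightOn q e' ≤ heightOn q e).card

/-- The edge `e` with its heights replaced by `colourHeight`. -/
def colourEdge (e : Edge n) : Edge n :=
  (e.1, e.2.1, colourHeight D c e.1 e, colourHeight D c e.2.1 e)

/-- The sum of the (relabelled) colour classes of the colours less than `k`. -/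
def colourSum (k : ℕ) : Finset (Edge n) :=
  dsumList ((List.range k).map fun j => rel (D.filter fun e => c e = j))

variable {D c}

lemma colourHeight_lt {q : Fin n} {e e' : Edge n} (he' : e' ∈ D) (hq' : Meets q e')
    (h : c e < c e' ∨ c e = c e' ∧ heightOn q e < heightOn q e') :
    colourHeight D c q e < colourHeight D c q e' := by
  apply Finset.card_lt_card
  refine ⟨fun x hx => ?_, fun hsub => ?_⟩
  · rw [Finset.mem_filter] at hx ⊢
    exact ⟨hx.1, by omega⟩
  · have := hsub (Finset.mem_filter.mpr ⟨mem_atPeg.mpr ⟨he', hq'⟩, Or.inr ⟨rfl, le_rfl⟩⟩)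
    have := (Finset.mem_filter.mp this).2
    omega

/-- On the left peg alone, the lexicographic order by colour and height already separates the edges.
-/
lemma Generic.colourEdge_injOn (hD : Generic D) : Set.InjOn (colourEdge D c) D := by
  intro e he e' he' h
  simp only [colourEdge, Prod.mk.injEq] at h
  obtain ⟨h1, -, h3, -⟩ := h
  have hq : Meets e.1 e := Or.inl rfl
  have hq' : Meets e.1 e' := Or.inl h1.symm
  rw [← h1] at h3
  apply hD.inj e.1 e he e' he' hq hq'
  by_contra hne
  rcases lt_trichotomy (c e) (c e') with hc | hc | hc
  · exact (colourHeight_lt (q := e.1) he' hq' (Or.inl hc)).ne h3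
  · rcases lt_or_gt_of_ne hne with hh | hh
    · exact (colourHeight_lt (q := e.1) he' hq' (Or.inr ⟨hc, hh⟩)).ne h3
    · exact (colourHeight_lt (q := e.1) he hq (Or.inr ⟨hc.symm, hh⟩)).ne h3.symm
  · exact (colourHeight_lt (q := e.1) he hq (Or.inl hc)).ne h3.symm

/-- The first summand is the height given by `rel` inside the colour class of `e`; the second is the
shift caused by the earlier colours. -/
lemma Generic.card_heights_le_add (hD : Generic D) (q : Fin n) (e : Edge n) :
    ((heights (D.filter fun e' => c e' = c e) q).filter fun h => h ≤ heightOn q e).card +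
      ((atPeg D q).filter fun e' => c e' < c e).card = colourHeight D c q e := by
  have hsub : Generic (D.filter fun e' => c e' = c e) := hD.mono (Finset.filter_subset _ _)
  rw [heights_eq_image hsub.lt, Finset.filter_image, Finset.card_image_of_injOn
    ((hsub.injOn q).mono (Finset.coe_subset.mpr (Finset.filter_subset _ _))), atPeg_filter,
    Finset.filter_filter, add_comm, colourHeight, Finset.filter_or, Finset.card_union_of_disjoint]
  rw [Finset.disjoint_left]
  intro x hx hx'
  rw [Finset.mem_filter] at hx hx'
  omega

lemma Generic.colourSum_eq (hD : Generic D) (k : ℕ) :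
    colourSum D c k = (D.filter fun e => c e < k).image (colourEdge D c) := by
  induction k with
  | zero => simp [colourSum, dsumList]
  | succ k ih =>
    have hstep : colourSum D c (k + 1) =
        dsum (colourSum D c k) (rel (D.filter fun e => c e = k)) := by
      rw [colourSum, List.range_succ, List.map_append, List.map_singleton,
        dsumList_append_singleton]
      rfl
    have hpeg : ∀ q, pegCount (colourSum D c k) q =
        ((atPeg D q).filter fun e => c e < k).card := by
      intro q
      rw [ih, pegCount_image (φ := colourEdge D c) (fun _ => ⟨rfl, rfl⟩), pegCount_eq, atPeg_filter]
      exact hD.colourEdge_injOn.mono (Finset.coe_subset.mpr (Finset.filter_subset _ _))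
    have hunion : (D.filter fun e => c e < k + 1) =
        (D.filter fun e => c e < k) ∪ D.filter fun e => c e = k := by
      rw [← Finset.filter_or]
      exact Finset.filter_congr fun e _ => by omega
    rw [hstep, dsum, ih, hunion, Finset.image_union, ← ih, shift, rel, Finset.image_image]
    congr 1
    refine Finset.image_congr fun e he => ?_
    obtain ⟨heD, rfl⟩ := Finset.mem_filter.mp (Finset.mem_coe.mp he)
    have h1 := hD.card_heights_le_add (c := c) e.1 e
    have h2 := hD.card_heights_le_add (c := c) e.2.1 e
    rw [heightOn_left] at h1
    rw [heightOn_right (hD.lt e heD)] at h2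
    simp only [Function.comp_apply, hpeg, colourEdge, h1, h2]

/-- On some peg, the edge `e` of `X` lies below the edge `e'` of `X`. -/
def Below (X : Finset (Edge n)) (e e' : Edge n) : Prop :=
  e ∈ X ∧ e' ∈ X ∧ ∃ q, Meets q e ∧ Meets q e' ∧ heightOn q e < heightOn q e'

/-- For such `c` the order by colour and then height agrees with the order by height alone. -/
lemma IsWebDiagram.colourHeight_eq (hD : IsWebDiagram D)
    (hc : ∀ e e', Below D e e' → c e ≤ c e') {q : Fin n} {e : Edge n} (he : e ∈ D)
    (hq : Meets q e) : colourHeight D c q e = heightOn q e := by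
  rw [← hD.card_le_heightOn he hq, colourHeight]
  congr 1
  refine Finset.filter_congr fun e' he' => ?_
  obtain ⟨he', hq'⟩ := mem_atPeg.mp he'
  rcases lt_trichotomy (heightOn q e') (heightOn q e) with h | h | h
  · have := hc e' e ⟨he', he, q, hq', hq, h⟩
    omega
  · have := hD.generic.inj q e' he' e he hq' hq h
    subst this
    simp
  · have := hc e e' ⟨he, he', q, hq, hq', h⟩
    omega

lemma IsWebDiagram.colourSum_eq_self (hD : IsWebDiagram D) {k : ℕ} (hk : ∀ e ∈ D, c e < k)
    (hc : ∀ e e', Below D e e' → c e ≤ c e') : colourSum D c k = D := by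
  rw [hD.generic.colourSum_eq, Finset.filter_true_of_mem hk, Finset.image_congr (g := id),
    Finset.image_id]
  intro e he
  have h1 := hD.colourHeight_eq hc he (Or.inl rfl : Meets e.1 e)
  have h2 := hD.colourHeight_eq hc he (Or.inr rfl : Meets e.2.1 e)
  rw [heightOn_left] at h1
  rw [heightOn_right (hD.1 e he)] at h2
  rw [colourEdge, h1, h2]
  rfl

/-- No two different edges join the same two pegs. -/
def IsSimple (D : Finset (Edge n)) : Prop :=
  ∀ e ∈ D, ∀ e' ∈ D, e.1 = e'.1 → e.2.1 = e'.2.1 → e = e'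

/-- Sorting keeps the pegs of an edge, so by simplicity an edge that lands in `D` lands on itself. A
colour inversion on a peg would then reverse two heights that are fixed. -/
lemma IsWebDiagram.colourSum_eq_self_iff (hD : IsWebDiagram D) (hs : IsSimple D) {k : ℕ}
    (hk : ∀ e ∈ D, c e < k) :
    colourSum D c k = D ↔ ∀ e e', Below D e e' → c e ≤ c e' := by
  refine ⟨fun h => ?_, hD.colourSum_eq_self hk⟩
  have hfix : ∀ e ∈ D, colourEdge D c e = e := by
    intro e he
    have hmem : colourEdge D c e ∈ D := by
      rw [hD.generic.colourSum_eq, Finset.filter_true_of_mem hk] at h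
      exact h.subset (Finset.mem_image_of_mem _ he)
    exact hs _ hmem e he rfl rfl
  have hht : ∀ e ∈ D, ∀ q, Meets q e → colourHeight D c q e = heightOn q e := by
    intro e he q hq
    have h1 := congrArg (fun x => x.2.2.1) (hfix e he)
    have h2 := congrArg (fun x => x.2.2.2) (hfix e he)
    simp only [colourEdge] at h1 h2
    rcases hq with rfl | rfl
    · rw [h1, heightOn_left]
    · rw [h2, heightOn_right (hD.1 e he)]
  rintro e e' ⟨he, he', q, hq, hq', hlt⟩
  by_contra hc
  have := colourHeight_lt (q := q) he hq (Or.inl (not_le.mp hc))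
  rw [hht e he q hq, hht e' he' q hq'] at this
  omega

end colour

/-- The default colour 0 outside `D` is harmless, as `colourSum` only looks at edges of `D`. -/
lemma recon_eq_colourSum {ℓ : ℕ} (D : Finset (Edge n)) (c : {e : Edge n // e ∈ D} → Fin ℓ) :
    recon D c = colourSum D (fun e => if h : e ∈ D then (c ⟨e, h⟩ : ℕ) else 0) ℓ := by
  rw [recon, colourSum]
  congr 1
  refine List.ext_getElem (by simp) fun j h1 h2 => ?_
  simp only [List.getElem_ofFn, List.getElem_map, List.getElem_range]
  congr 1
  ext e
  simp only [colourClass, Finset.mem_image, Finset.mem_filter, Finset.mem_attach, true_and,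
    Subtype.exists, exists_and_right, exists_eq_right]
  constructor
  · rintro ⟨he, hc⟩
    exact ⟨he, by rw [dif_pos he, hc]⟩
  · rintro ⟨he, hc⟩
    rw [dif_pos he] at hc
    exact ⟨he, Fin.ext hc⟩

lemma mem_colourings_self {D : Finset (Edge n)} (hD : IsWebDiagram D) (hs : IsSimple D) {ℓ : ℕ}
    {c : {e : Edge n // e ∈ D} → Fin ℓ} :
    c ∈ colourings D D ℓ ↔
      Function.Surjective c ∧ ∀ e e' : {e // e ∈ D}, Below D e e' → c e ≤ c e' := by
  simp only [colourings, Finset.mem_filter, Finset.mem_univ, true_and, recon_eq_colourSum]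
  refine and_congr_right fun _ => ?_
  rw [hD.colourSum_eq_self_iff hs fun e he => by rw [dif_pos he]; exact (c _).isLt]
  constructor
  · intro h e e' hb
    have := h e e' hb
    rw [dif_pos e.2, dif_pos e'.2] at this
    exact this
  · intro h e e' hb
    rw [dif_pos hb.1, dif_pos hb.2.1]
    exact h ⟨e, hb.1⟩ ⟨e', hb.2.1⟩ hb

end WebWorld

/-! ### Decompositions into indecomposables and the preorder on edges. -/

namespace WebWorld

variable {n : ℕ}

open Relation

lemma exists_isDecomposition {D : Finset (Edge n)} (hD : IsWebDiagram D) :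
    ∃ Es, IsDecomposition D Es := by
  induction h : D.card using Nat.strong_induction_on generalizing D with
  | _ m ih =>
    by_cases hne : D.Nonempty
    · by_cases hind : IsIndecomposable D
      · exact ⟨[D], by simpa using hind, (empty_dsum D).symm⟩
      · have hdec : ∃ E F : Finset (Edge n), IsWebDiagram E ∧ IsWebDiagram F ∧ E.Nonempty ∧
            F.Nonempty ∧ D = dsum E F := by
          by_contra hcon
          exact hind ⟨hD, hne, hcon⟩
        obtain ⟨E, F, hE, hF, hEne, hFne, rfl⟩ := hdec
        rw [hE.card_dsum hF] at h
        have := hEne.card_pos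
        have := hFne.card_pos
        obtain ⟨Es, hEs, hEs'⟩ := ih E.card (by omega) hE rfl
        obtain ⟨Fs, hFs, hFs'⟩ := ih F.card (by omega) hF rfl
        refine ⟨Es ++ Fs, ?_, ?_⟩
        · intro x hx
          rcases List.mem_append.mp hx with hx | hx
          · exact hEs x hx
          · exact hFs x hx
        · rw [dsumList_append _ _ (fun x hx => (hEs x hx).1) (fun x hx => (hFs x hx).1), ← hEs',
            ← hFs']
    · rw [Finset.not_nonempty_iff_eq_empty] at hne
      exact ⟨[], by simp, by simp [hne, dsumList]⟩

section blocks

variable {Es : List (Finset (Edge n))}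

lemma dsumList_take_succ (i : Fin Es.length) :
    dsumList (Es.take (i.1 + 1)) = dsumList (Es.take i.1) ∪ block Es i := by
  rw [← List.take_append_getElem i.2, dsumList_append_singleton]
  rfl

lemma mem_dsumList_take {k : ℕ} (hk : k ≤ Es.length) (e : Edge n) :
    e ∈ dsumList (Es.take k) ↔ ∃ i : Fin Es.length, i.1 < k ∧ e ∈ block Es i := by
  induction k with
  | zero => simp [dsumList]
  | succ k ih =>
    rw [dsumList_take_succ ⟨k, hk⟩, Finset.mem_union, ih (by omega)]
    constructor
    · rintro (⟨i, hi, he⟩ | he)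
      · exact ⟨i, by omega, he⟩
      · exact ⟨⟨k, hk⟩, Nat.lt_succ_self k, he⟩
    · rintro ⟨i, hi, he⟩
      rcases Nat.lt_succ_iff_lt_or_eq.mp hi with h | h
      · exact Or.inl ⟨i, h, he⟩
      · right
        rwa [show (⟨k, hk⟩ : Fin Es.length) = i from Fin.ext h.symm]

lemma mem_dsumList (e : Edge n) : e ∈ dsumList Es ↔ ∃ i, e ∈ block Es i := by
  have := mem_dsumList_take (Es := Es) le_rfl e
  rw [List.take_length] at this
  rw [this]
  exact ⟨fun ⟨i, _, h⟩ => ⟨i, h⟩, fun ⟨i, h⟩ => ⟨i, i.2, h⟩⟩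

variable (hEs : ∀ E ∈ Es, IsWebDiagram E)
include hEs

lemma pegCount_dsumList_take_succ (i : Fin Es.length) (q : Fin n) :
    pegCount (dsumList (Es.take (i.1 + 1))) q =
      pegCount (dsumList (Es.take i.1)) q + pegCount (Es.get i) q := by
  rw [← List.take_append_getElem i.2, dsumList_append_singleton, IsWebDiagram.pegCount_dsum]
  · rfl
  · exact isWebDiagram_dsumList _ fun E hE => hEs E (List.mem_of_mem_take hE)
  · exact hEs _ (List.getElem_mem i.2)

lemma pegCount_dsumList_take_mono (q : Fin n) :
    Monotone fun k => pegCount (dsumList (Es.take k)) q := by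
  refine monotone_nat_of_le_succ fun k => ?_
  by_cases hk : k < Es.length
  · rw [pegCount_dsumList_take_succ hEs ⟨k, hk⟩]
    exact Nat.le_add_right _ _
  · rw [List.take_of_length_le (not_lt.mp hk), List.take_of_length_le (by omega)]

lemma heightOn_mem_of_mem_block {i : Fin Es.length} {e : Edge n} (he : e ∈ block Es i)
    {q : Fin n} (hq : Meets q e) :
    pegCount (dsumList (Es.take i.1)) q < heightOn q e ∧
      heightOn q e ≤ pegCount (dsumList (Es.take (i.1 + 1))) q := by
  rw [block, shift_eq, Finset.mem_image] at he
  obtain ⟨x, hx, rfl⟩ := he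
  have hqx : Meets q x := hq
  have := (hEs _ (List.get_mem Es i)).heightOn_mem hx hqx
  rw [Finset.mem_Icc] at this
  rw [heightOn_relabelEdge _ hqx, pegCount_dsumList_take_succ hEs i]
  omega

lemma heightOn_lt_of_block_lt {i j : Fin Es.length} (hij : i < j) {e e' : Edge n}
    (he : e ∈ block Es i) (he' : e' ∈ block Es j) {q : Fin n} (hq : Meets q e)
    (hq' : Meets q e') : heightOn q e < heightOn q e' :=
  ((heightOn_mem_of_mem_block hEs he hq).2.trans
    (pegCount_dsumList_take_mono hEs q (Nat.succ_le_of_lt hij))).trans_lt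
    (heightOn_mem_of_mem_block hEs he' hq').1

lemma block_index_unique {i j : Fin Es.length} {e : Edge n} (he : e ∈ block Es i)
    (he' : e ∈ block Es j) : i = j := by
  rcases lt_trichotomy i j with h | h | h
  · exact absurd (heightOn_lt_of_block_lt hEs h he he' (Or.inl rfl) (Or.inl rfl)) (lt_irrefl _)
  · exact h
  · exact absurd (heightOn_lt_of_block_lt hEs h he' he (Or.inl rfl) (Or.inl rfl)) (lt_irrefl _)

end blocks

/-- Colour `U` by 1 and its complement by 0. This is monotone along `Below`, so the reconstruction
returns `E` as a sum of two parts, both nonempty if `U` is proper. -/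
lemma IsIndecomposable.eq_of_upper {E : Finset (Edge n)} (hE : IsIndecomposable E)
    {U : Finset (Edge n)} (hU : U ⊆ E) (hne : U.Nonempty)
    (hup : ∀ e e', Below E e e' → e ∈ U → e' ∈ U) : U = E := by
  by_contra hUE
  obtain ⟨x, hxE, hxU⟩ : ∃ x ∈ E, x ∉ U := by
    by_contra! h
    exact hUE (Finset.Subset.antisymm hU h)
  obtain ⟨y, hy⟩ := hne
  let c : Edge n → ℕ := fun e => if e ∈ U then 1 else 0
  have hsum := hE.1.colourSum_eq_self (c := c) (k := 2)
    (fun e _ => by simp only [c]; split_ifs <;> omega) fun e e' hb => by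
      simp only [c]
      split_ifs with h1 h2
      · exact le_rfl
      · exact absurd (hup e e' hb h1) h2
      · omega
      · exact le_rfl
  have hgen : ∀ j, Generic (E.filter fun e => c e = j) :=
    fun j => hE.1.generic.mono (Finset.filter_subset _ _)
  refine hE.2.2 ⟨rel (E.filter fun e => c e = 0), rel (E.filter fun e => c e = 1),
    (hgen 0).isWebDiagram_rel, (hgen 1).isWebDiagram_rel, ?_, ?_, ?_⟩
  · exact Finset.Nonempty.image ⟨x, by simp [c, hxE, hxU]⟩ _
  · exact Finset.Nonempty.image ⟨y, by simp [c, hU hy, hy]⟩ _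
  · conv_lhs => rw [← hsum]
    simp [colourSum, dsumList, List.range_succ, empty_dsum]

section index

variable {D : Finset (Edge n)} {Es : List (Finset (Edge n))}

lemma IsDecomposition.isWebDiagram (h : IsDecomposition D Es) : ∀ E ∈ Es, IsWebDiagram E :=
  fun E hE => (h.1 E hE).1

lemma IsDecomposition.block_subset (h : IsDecomposition D Es) (i : Fin Es.length) :
    block Es i ⊆ D := by
  intro e he
  rw [h.2, mem_dsumList]
  exact ⟨i, he⟩

/-- Blocks are strongly connected: the edges reachable from a given one form a nonempty upper set of
an indecomposable diagram, hence all of it. -/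
lemma IsDecomposition.reflTransGen_of_mem_block (h : IsDecomposition D Es) {i : Fin Es.length}
    {e e' : Edge n} (he : e ∈ block Es i) (he' : e' ∈ block Es i) :
    ReflTransGen (Below D) e e' := by
  classical
  have hsub := h.block_subset i
  set φ := relabelEdge fun q h => h + pegCount (dsumList (Es.take i.1)) q with hφ
  have hblock : block Es i = (Es.get i).image φ := rfl
  rw [hblock] at he he' hsub
  obtain ⟨x, hx, rfl⟩ := Finset.mem_image.mp he
  obtain ⟨x', hx', rfl⟩ := Finset.mem_image.mp he'
  have hU := (h.1 _ (List.get_mem Es i)).eq_of_upper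
    (U := (Es.get i).filter fun y => ReflTransGen (Below D) (φ x) (φ y))
    (Finset.filter_subset _ _) ⟨x, Finset.mem_filter.mpr ⟨hx, .refl⟩⟩ (by
      rintro a b ⟨ha, hb, q, hqa, hqb, hlt⟩ haU
      refine Finset.mem_filter.mpr ⟨hb, (Finset.mem_filter.mp haU).2.tail ?_⟩
      refine ⟨hsub (Finset.mem_image_of_mem _ ha), hsub (Finset.mem_image_of_mem _ hb), q, hqa, hqb,
        ?_⟩
      rw [hφ, heightOn_relabelEdge _ hqa, heightOn_relabelEdge _ hqb]
      exact Nat.add_lt_add_right hlt _)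
  rw [← hU] at hx'
  exact (Finset.mem_filter.mp hx').2

lemma IsDecomposition.isWebDiagram_self (h : IsDecomposition D Es) : IsWebDiagram D := by
  rw [h.2]
  exact isWebDiagram_dsumList Es h.isWebDiagram

/-- `P` is the quotient of the preorder generated by `Below D` by its symmetric part. -/
def Represents (D : Finset (Edge n)) (P : NaturalPoset) : Prop :=
  ∃ f : {e // e ∈ D} → Fin P.size, Function.Surjective f ∧
    ∀ e e' : {e // e ∈ D}, ReflTransGen (Below D) e e' ↔ P.le (f e) (f e')

/-- The map sends an edge to the index of its block. Paths of edges project to chains of blocks, and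
chains of blocks lift because each block is strongly connected. -/
lemma IsDecomposition.represents (h : IsDecomposition D Es) : Represents D (posetOfList Es) := by
  have hweb := h.isWebDiagram
  have hmem : ∀ e : {e // e ∈ D}, ∃ i, e.1 ∈ block Es i := by
    intro e
    rw [← mem_dsumList, ← h.2]
    exact e.2
  choose f hf using hmem
  refine ⟨f, ?_, ?_⟩
  · intro i
    obtain ⟨x, hx⟩ : (block Es i).Nonempty := (h.1 _ (List.get_mem Es i)).2.1.image _
    exact ⟨⟨x, h.block_subset i hx⟩, block_index_unique hweb (hf ⟨x, h.block_subset i hx⟩) hx⟩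
  · rintro ⟨e, he⟩ ⟨e', he'⟩
    constructor
    · intro hpath
      simp only at hpath
      induction hpath with
      | refl => exact (posetOfList Es).le_refl _
      | @tail b b' _ hb ih =>
        refine (posetOfList Es).le_trans _ _ _ (ih hb.1) ?_
        obtain ⟨hbD, hbD', q, hq, hq', hlt⟩ := hb
        have hfb := hf ⟨b, hbD⟩
        have hfb' := hf ⟨b', he'⟩
        rcases lt_trichotomy (f ⟨b, hbD⟩) (f ⟨b', he'⟩) with hij | hij | hij
        · refine ReflTransGen.single ⟨hij, b, hfb, b', hfb', q, _, _, ?_, ?_, hlt⟩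
          · exact (mem_endpoints_iff (h.isWebDiagram_self.1 b hbD)).mpr ⟨hq, rfl⟩
          · exact (mem_endpoints_iff (h.isWebDiagram_self.1 b' hbD')).mpr ⟨hq', rfl⟩
        · rw [hij]
          exact (posetOfList Es).le_refl _
        · exact absurd hlt (heightOn_lt_of_block_lt hweb hij hfb' hfb hq' hq).asymm
    · intro hle
      -- Reaching every edge of the last block lets the induction continue from whichever edge
      -- witnesses the next `IsBelow` step.
      have key : ∀ i j, ReflTransGen (IsBelow Es) i j → e ∈ block Es i →
          ∀ x ∈ block Es j, ReflTransGen (Below D) e x := by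
        intro i j hij hei
        induction hij with
        | refl => exact fun x hx => h.reflTransGen_of_mem_block hei hx
        | @tail k j _ hkj ih =>
          intro x hx
          obtain ⟨-, a, ha, b, hb, q, s, t, hs, ht, hst⟩ := hkj
          have haD := h.block_subset _ ha
          have hbD := h.block_subset _ hb
          rw [mem_endpoints_iff (h.isWebDiagram_self.1 a haD)] at hs
          rw [mem_endpoints_iff (h.isWebDiagram_self.1 b hbD)] at ht
          have hab : Below D a b := ⟨haD, hbD, q, hs.1, ht.1, by rw [← hs.2, ← ht.2]; exact hst⟩
          exact ((ih a ha).tail hab).trans (h.reflTransGen_of_mem_block hb hx)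
      exact key _ _ hle (hf ⟨e, he⟩) e' (hf ⟨e', he'⟩)

end index

/-! ### The quotient poset: uniqueness, and its role in counting colourings. -/

section represents

variable {D : Finset (Edge n)} {P Q : NaturalPoset}

/-- Antisymmetry is not a field of the structure; natural labelling supplies it. -/
lemma NaturalPoset.antisymm (P : NaturalPoset) {i j : Fin P.size} (h : P.le i j)
    (h' : P.le j i) : i = j :=
  _root_.le_antisymm (P.natural i j h) (P.natural j i h')

/-- Both maps identify exactly the mutually reachable edges, so passing through a section of either
one gives inverse isomorphisms. -/
lemma Represents.equiv (hP : Represents D P) (hQ : Represents D Q) : P ≈ Q := by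
  obtain ⟨f, hf, hfle⟩ := hP
  obtain ⟨g, hg, hgle⟩ := hQ
  have hfg : ∀ e e', f e = f e' ↔ g e = g e' := by
    intro e e'
    constructor
    · intro h
      refine Q.antisymm ((hgle e e').mp ((hfle e e').mpr ?_))
        ((hgle e' e).mp ((hfle e' e).mpr ?_)) <;> rw [h] <;> exact P.le_refl _
    · intro h
      refine P.antisymm ((hfle e e').mp ((hgle e e').mpr ?_))
        ((hfle e' e).mp ((hgle e' e).mpr ?_)) <;> rw [h] <;> exact Q.le_refl _
  have hgs : ∀ e, g (Function.surjInv hf (f e)) = g e :=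
    fun e => (hfg _ _).mp (Function.surjInv_eq hf (f e))
  have hfs : ∀ e, f (Function.surjInv hg (g e)) = f e :=
    fun e => (hfg _ _).mpr (Function.surjInv_eq hg (g e))
  refine ⟨⟨⟨fun i => g (Function.surjInv hf i), fun j => f (Function.surjInv hg j), ?_, ?_⟩, ?_⟩⟩
  · intro i
    simp only
    rw [hfs, Function.surjInv_eq hf]
  · intro j
    simp only
    rw [hgs, Function.surjInv_eq hg]
  · intro i j
    simp only [Equiv.coe_fn_mk]
    rw [← hgle, hfle, Function.surjInv_eq hf, Function.surjInv_eq hf]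

lemma Represents.of_equiv (hP : Represents D P) (hPQ : P ≈ Q) : Represents D Q := by
  obtain ⟨f, hf, hfle⟩ := hP
  obtain ⟨φ⟩ := hPQ
  refine ⟨fun e => φ (f e), φ.surjective.comp hf, fun e e' => ?_⟩
  rw [hfle]
  exact φ.map_rel_iff.symm

lemma Represents.size_pos (hP : Represents D P) (hD : D.Nonempty) : 0 < P.size := by
  obtain ⟨f, -⟩ := hP
  obtain ⟨e, he⟩ := hD
  exact (f ⟨e, he⟩).pos

lemma Represents.size_le (hP : Represents D P) : P.size ≤ D.card := by
  obtain ⟨f, hf, -⟩ := hP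
  simpa using Fintype.card_le_of_surjective f hf

/-- A colouring that is monotone along `Below` is constant on mutually reachable edges, so it
factors uniquely through the quotient `f`. -/
lemma Represents.numColourings_eq (hP : Represents D P) (hD : IsWebDiagram D) (hs : IsSimple D)
    (ℓ : ℕ) : numColourings D D ℓ = (chainSurjections P ℓ).card := by
  obtain ⟨f, hf, hfle⟩ := hP
  symm
  refine Finset.card_bij (fun g _ => g ∘ f) ?_ ?_ ?_
  · intro g hg
    rw [mem_chainSurjections] at hg
    rw [mem_colourings_self hD hs]
    exact ⟨hg.1.comp hf, fun e e' h => hg.2 _ _ ((hfle e e').mp (.single h))⟩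
  · intro g _ g' _ h
    exact hf.injective_comp_right h
  · intro c hc
    obtain ⟨hcs, hcle⟩ := (mem_colourings_self hD hs).mp hc
    have hpath : ∀ e e' : {e // e ∈ D}, ReflTransGen (Below D) e e' → c e ≤ c e' := by
      rintro ⟨e, he⟩ ⟨e', he'⟩ h
      simp only at h
      induction h with
      | refl => exact le_rfl
      | tail _ hb ih => exact (ih hb.1).trans (hcle ⟨_, hb.1⟩ ⟨_, he'⟩ hb)
    have hconst : ∀ e, c (Function.surjInv hf (f e)) = c e := by
      intro e
      have h := Function.surjInv_eq hf (f e)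
      refine le_antisymm (hpath _ _ ((hfle _ _).mpr ?_)) (hpath _ _ ((hfle _ _).mpr ?_)) <;>
        rw [h] <;> exact P.le_refl _
    have hcomp : (fun i => c (Function.surjInv hf i)) ∘ f = c := funext hconst
    refine ⟨fun i => c (Function.surjInv hf i), ?_, hcomp⟩
    rw [mem_chainSurjections]
    refine ⟨fun v => ?_, fun i j hij => hpath _ _ ((hfle _ _).mpr ?_)⟩
    · obtain ⟨e, rfl⟩ := hcs v
      exact ⟨f e, hconst e⟩
    · rwa [Function.surjInv_eq hf, Function.surjInv_eq hf]

end represents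

lemma IsDecompositionPoset.represents {D : Finset (Edge n)} {P : NaturalPoset}
    (h : IsDecompositionPoset D (Quotient.mk posetSetoid P)) : Represents D P := by
  obtain ⟨Es, hEs, hP⟩ := h
  exact hEs.represents.of_equiv (Setoid.symm (Quotient.exact hP))

lemma IsWebDiagram.existsUnique_decompositionPoset {D : Finset (Edge n)} (hD : IsWebDiagram D) :
    ∃! P : PosetClass, IsDecompositionPoset D P := by
  obtain ⟨Es, hEs⟩ := exists_isDecomposition hD
  refine ⟨Quotient.mk posetSetoid (posetOfList Es), ⟨Es, hEs, rfl⟩, ?_⟩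
  rintro P ⟨Fs, hFs, rfl⟩
  exact Quotient.sound (hFs.represents.equiv hEs.represents)

end WebWorld

/-! ### Passing to the whole web world and summing over posets. -/

namespace WebWorld

open Polynomial

variable {n : ℕ}

lemma isWebDiagram_of_mem_webWorld {D₀ D : Finset (Edge n)} (h₀ : IsWebDiagram D₀)
    (hD : D ∈ webWorld D₀) : IsWebDiagram D := by
  obtain ⟨π, -, rfl⟩ := Finset.mem_image.mp hD
  refine isWebDiagram_relabel (H := fun q h => Equiv.Perm.ofSubtype (π q) h) h₀.1
    (fun q => (Equiv.injective _).injOn) fun q => ?_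
  rw [h₀.2]
  apply Finset.eq_of_subset_of_card_le
  · intro x hx
    obtain ⟨h, hh, rfl⟩ := Finset.mem_image.mp hx
    rw [Equiv.Perm.ofSubtype_apply_of_mem _ hh]
    exact (π q ⟨h, hh⟩).2
  · rw [Finset.card_image_of_injective _ (Equiv.injective _)]

lemma IsSimple.of_mem_webWorld {D₀ D : Finset (Edge n)} (h₀ : IsSimple D₀)
    (hD : D ∈ webWorld D₀) : IsSimple D := by
  obtain ⟨π, -, rfl⟩ := Finset.mem_image.mp hD
  intro e he e' he' hx hy
  obtain ⟨a, ha, rfl⟩ := Finset.mem_image.mp he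
  obtain ⟨b, hb, rfl⟩ := Finset.mem_image.mp he'
  rw [h₀ a ha b hb hx hy]

lemma nonempty_of_mem_webWorld {D₀ D : Finset (Edge n)} (h₀ : D₀.Nonempty)
    (hD : D ∈ webWorld D₀) : D.Nonempty := by
  obtain ⟨π, -, rfl⟩ := Finset.mem_image.mp hD
  exact h₀.image _

lemma IsWebDiagram.isSimple {D : Finset (Edge n)} (hD : IsWebDiagram D)
    (hlabel : ∀ e ∈ (webGraph D).edgeSet, webGraphLabel D e = 1) : IsSimple D := by
  intro e he e' he' hx hy
  have hl : e.1 ∈ pegSet D := Finset.mem_union_left _ (Finset.mem_image_of_mem _ he)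
  have hr : e.2.1 ∈ pegSet D := Finset.mem_union_right _
    (Finset.mem_image_of_mem (fun e : Edge n => e.2.1) he)
  have hadj : s((⟨e.1, hl⟩ : {i // i ∈ pegSet D}), ⟨e.2.1, hr⟩) ∈ (webGraph D).edgeSet := by
    rw [SimpleGraph.mem_edgeSet, webGraph, SimpleGraph.fromRel_adj]
    exact ⟨fun h => (hD.1 e he).ne (congrArg Subtype.val h), Or.inl ⟨e, he, rfl, rfl⟩⟩
  have hcard := hlabel _ hadj
  refine Finset.card_le_one.mp hcard.le e (Finset.mem_filter.mpr ⟨he, ?_⟩) e'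
    (Finset.mem_filter.mpr ⟨he', ?_⟩)
  · rw [Sym2.map_mk]
  · rw [Sym2.map_mk, ← hx, ← hy]

section fiberwise

variable {W : Finset (Finset (Edge n))}
  (huniq : ∀ D ∈ W, ∃! P : PosetClass, IsDecompositionPoset D P)
include huniq

lemma finite_allPosets : (AllPosets W).Finite := by
  have hsub : AllPosets W ⊆ ⋃ D ∈ W, {P | IsDecompositionPoset D P} := by
    rintro P ⟨D, hD, hP⟩
    exact Set.mem_iUnion₂.mpr ⟨D, hD, hP⟩
  refine (W.finite_toSet.biUnion fun D hD => ?_).subset hsub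
  exact Set.Subsingleton.finite fun P hP Q hQ => (huniq D hD).unique hP hQ

lemma sum_eq_finsum_allPosets {R : Type*} [CommSemiring R] (F : PosetClass → R)
    (G : Finset (Edge n) → R) (hG : ∀ D ∈ W, ∀ P, IsDecompositionPoset D P → G D = F P) :
    ∑ D ∈ W, G D = ∑ᶠ (P : PosetClass) (_ : P ∈ AllPosets W), (multip W P : R) * F P := by
  classical
  -- `choose!` needs a default value for `p` outside `W`; any class will do.
  have : Nonempty PosetClass := ⟨Quotient.mk posetSetoid (posetOfList ([] : List (Finset (Edge n))))⟩
  choose! p hp using fun D hD => (huniq D hD).exists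
  have hiff : ∀ D ∈ W, ∀ P, IsDecompositionPoset D P ↔ p D = P := fun D hD P =>
    ⟨fun h => (huniq D hD).unique (hp D hD) h, fun h => h ▸ hp D hD⟩
  have hall : AllPosets W = ↑(W.image p) := by
    ext P
    simp only [AllPosets, Set.mem_ofPred_eq, Finset.coe_image, Set.mem_image, Finset.mem_coe]
    exact exists_congr fun D => and_congr_right fun hD => hiff D hD P
  have hmult : ∀ P, multip W P = (W.filter fun D => p D = P).card := by
    intro P
    rw [multip, ← Set.ncard_coe_finset]
    congr 1
    ext D
    simp only [Set.mem_ofPred_eq, Finset.coe_filter]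
    exact and_congr_right fun hD => hiff D hD P
  rw [hall, finsum_mem_coe_finset, Finset.sum_congr rfl fun D hD => hG D hD _ (hp D hD),
    Finset.sum_comp F p]
  exact Finset.sum_congr rfl fun P _ => by rw [hmult, nsmul_eq_mul]

end fiberwise

lemma sum_numColourings_self {D : Finset (Edge n)} (hD : IsWebDiagram D) (hs : IsSimple D)
    (hne : D.Nonempty) {P : NaturalPoset} (hP : Represents D P) :
    ∑ ℓ ∈ Finset.Icc 1 D.card, (X : ℚ[X]) ^ ℓ * (numColourings D D ℓ : ℚ[X]) =
      ∑ π ∈ jordanHolder P, (X : ℚ[X]) ^ (1 + des π) * (1 + X) ^ (P.size - 1 - des π) := by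
  rw [← sum_card_chainSurjections P (hP.size_pos hne) D.card hP.size_le]
  exact Finset.sum_congr rfl fun ℓ _ => by rw [hP.numColourings_eq hD hs]

lemma sum_mixing_numColourings_self {D : Finset (Edge n)} (hD : IsWebDiagram D) (hs : IsSimple D)
    (hne : D.Nonempty) {P : NaturalPoset} (hP : Represents D P) :
    ∑ ℓ ∈ Finset.Icc 1 D.card, ((-1 : ℚ) ^ (ℓ - 1) / (ℓ : ℚ)) * (numColourings D D ℓ : ℚ) =
      ∑ π ∈ jordanHolder P,
        (-1 : ℚ) ^ des π / (P.size * ((P.size - 1).choose (des π) : ℚ)) := by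
  have h := congrArg mixingFunctional (sum_numColourings_self hD hs hne hP)
  simp only [map_sum, mixingFunctional_pow_mul_natCast,
    mixingFunctional_chain_polynomial (hP.size_pos hne)] at h
  exact h

end WebWorld

theorem corollary3p4 (n : ℕ) (D₀ : Finset (Edge n)) (hD₀ : IsWebDiagram D₀)
    (hne : D₀.Nonempty)
    (hlabel : ∀ e ∈ (webGraph D₀).edgeSet, webGraphLabel D₀ e = 1)
    (rep : PosetClass → NaturalPoset)
    (hrep : ∀ P : PosetClass, Quotient.mk posetSetoid (rep P) = P) :
    (∀ D ∈ webWorld D₀, ∃! P : PosetClass, IsDecompositionPoset D P) ∧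
    (AllPosets (webWorld D₀)).Finite ∧
    ((colouringMatrix (webWorld D₀)).trace =
        ∑ D : {D // D ∈ webWorld D₀}, colouringMatrix (webWorld D₀) D D ∧
      (colouringMatrix (webWorld D₀)).trace =
        ∑ᶠ (P : PosetClass) (_ : P ∈ AllPosets (webWorld D₀)),
          (multip (webWorld D₀) P : ℚ[X]) *
            ∑ π ∈ jordanHolder (rep P),
              (X : ℚ[X]) ^ (1 + des π) * (1 + X) ^ ((rep P).size - 1 - des π)) ∧
    ((mixingMatrix (webWorld D₀)).trace =
        ∑ D : {D // D ∈ webWorld D₀}, mixingMatrix (webWorld D₀) D D ∧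
      (mixingMatrix (webWorld D₀)).trace =
        ∑ᶠ (P : PosetClass) (_ : P ∈ AllPosets (webWorld D₀)),
          (multip (webWorld D₀) P : ℚ) *
            ∑ π ∈ jordanHolder (rep P),
              (-1 : ℚ) ^ des π /
                ((rep P).size * (((rep P).size - 1).choose (des π) : ℚ))) := by
  have hweb := fun D (hD : D ∈ webWorld D₀) => isWebDiagram_of_mem_webWorld hD₀ hD
  have hsimple := fun D (hD : D ∈ webWorld D₀) => (hD₀.isSimple hlabel).of_mem_webWorld hD
  have hnonempty := fun D (hD : D ∈ webWorld D₀) => nonempty_of_mem_webWorld hne hD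
  have huniq := fun D hD => (hweb D hD).existsUnique_decompositionPoset
  -- `Represents` is invariant under isomorphism, which is why the choice of natural labelling does
  -- not matter.
  have hrepr : ∀ D ∈ webWorld D₀, ∀ P, IsDecompositionPoset D P → Represents D (rep P) :=
    fun D _ P hP => IsDecompositionPoset.represents (by rwa [hrep P])
  refine ⟨huniq, finite_allPosets huniq, ⟨rfl, ?_⟩, ⟨rfl, ?_⟩⟩
  · rw [← sum_eq_finsum_allPosets huniq _
      (fun D => ∑ ℓ ∈ Finset.Icc 1 D.card, (X : ℚ[X]) ^ ℓ * (numColourings D D ℓ : ℚ[X]))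
      fun D hD P hP => sum_numColourings_self (hweb D hD) (hsimple D hD) (hnonempty D hD)
        (hrepr D hD P hP), ← Finset.sum_coe_sort]
    rfl
  · rw [← sum_eq_finsum_allPosets huniq _
      (fun D => ∑ ℓ ∈ Finset.Icc 1 D.card,
        ((-1 : ℚ) ^ (ℓ - 1) / (ℓ : ℚ)) * (numColourings D D ℓ : ℚ))
      fun D hD P hP => sum_mixing_numColourings_self (hweb D hD) (hsimple D hD) (hnonempty D hD)
        (hrepr D hD P hP), ← Finset.sum_coe_sort]
    rfl
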